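/- Let $SG\subset\mathbb R^2$ be the Sierpinski gasket generated by the contractions $F_i x=(x+q_i)/2$, $i=0,1,2$, where $q_0,q_1,q_2$ are the vertices of an equilateral triangle. Write $F_w=F_{w_1}\circ\cdots\circ F_{w_m}$ for a word $w$ of length $|w|=m$, $V_0=\{q_0,q_1,q_2\}$ and $V_m=\bigcup_{|w|=m}F_wV_0$. Let $\mu$ be the standard self-similar probability measure ($\mu(F_wSG)=3^{-|w|}$) and let $$\mathcal E(u,v)=\lim_{m\to\infty}\Big(\tfrac53\Big)^m\sum_{|w|=m}\ \sum_{0\le i<j\le 2}\big(u(F_wq_i)-u(F_wq_j)\big)\big(v(F_wq_i)-v(F_wq_j)\big)$$ be the standard energy, with domain $\operatorname{dom}\mathcal E$ the continuous functions $u:SG\to\mathbb R$ with $\mathcal E(u,u)<\infty$. A function $u\in\operatorname{dom}\mathcal E$ belongs to $\operatorname{dom}_{L^2}\Delta$, with $\Delta u=f\in L^2(\mu)$, if $\mathcal E(u,v)=-\int fv\,d\mu$ for all $v\in\operatorname{dom}\mathcal E$ with $v|_{V_0}=0$. Put $T_\mu(u)=\int(\Delta u)^2\,d\mu$. Let $$G(x,y)=\sum_{m=0}^{\infty}\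 \sum_{z,z'\in V_{m+1}\setminus V_m}g(z,z')\,\psi^{(m+1)}_z(x)\,\psi^{(m+1)}_{z'}(y)$$ be the Dirichlet Green's function, where $\psi^{(m)}_z$ is the continuous function that is harmonic on every cell $F_wSG$ with $|w|=m$, equals $1$ at $z$ and vanishes on $V_m\setminus\{z\}$, and $g(z,z)=\frac9{50}(\frac35)^m$, $g(z,z')=\frac3{50}(\frac35)^m$ if $z\ne z'$ lie in the same cell $F_wSG$ with $|w|=m$, and $g(z,z')=0$ otherwise. **Lemma.** Let $x_1,\dots,x_n$ be distinct points of $SG\setminus V_0$ and $E=\{x_1,\dots,x_n\}$. Then the $n\times n$ matrix $$[G]_{ij}=\int G(x_i,y)\,G(x_j,y)\,d\mu(y)$$ is invertible. Hence for all $a_1,\dots,a_n\in\mathbb R$ there are unique constants $c_1,\dots,c_n\in\mathbb R$ such that $$u(x)=\sum_{i=1}^n c_i\int G(x,y)\,G(x_i,y)\,d\mu(y)$$ satisfies $u(x_j)=a_j$ for all $j$, and this $u$ is the unique minimizer of $T_\mu$ over the set of all $v\in\operatorname{dom}_{L^2}\Delta$ with $v|_{V_0}=0$ and $v(x_j)=a_j$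 for all $j$. -/

import Mathlib

open scoped ENNReal
open Filter Topology MeasureTheory

noncomputable section

namespace Gasket

/-! ## The Sierpinski gasket -/

/-- The vertices of the unit equilateral triangle. -/
def vertex (i : Fin 3) : EuclideanSpace ℝ (Fin 2) :=
  ![!₂[0, 0], !₂[1, 0], !₂[1 / 2, √3 / 2]] i

/-- The point of the plane with address `ω`, i.e. the limit of
`F_{ω 0} ∘ ⋯ ∘ F_{ω (n - 1)}` applied to any point, where `F_i x = (x + q_i) / 2`. -/
def addressPoint (ω : ℕ → Fin 3) : EuclideanSpace ℝ (Fin 2) :=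
  ∑' n, (1 / 2 : ℝ) ^ (n + 1) • vertex (ω n)

/-- The Sierpinski gasket, as a subset of the plane: all points that have an address. -/
def gasketSet : Set (EuclideanSpace ℝ (Fin 2)) := Set.range addressPoint

/-- The Sierpinski gasket as a (metric, Borel) space. -/
abbrev SG : Type := gasketSet

/-- The coding map from the space of addresses onto the gasket. -/
def code (ω : ℕ → Fin 3) : SG := ⟨addressPoint ω, ω, rfl⟩

/-- The address `i ω₀ ω₁ ω₂ …`. -/
def push (i : Fin 3) (ω : ℕ → Fin 3) : ℕ → Fin 3
  | 0 => i
  | n + 1 => ω n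

theorem norm_vertex_le (i : Fin 3) : ‖vertex i‖ ≤ 1 := by
  fin_cases i <;> simp [vertex, EuclideanSpace.norm_eq, Fin.sum_univ_two, div_pow]; norm_num

theorem norm_term_le (n : ℕ) (i : Fin 3) :
    ‖(1 / 2 : ℝ) ^ (n + 1) • vertex i‖ ≤ (1 / 2 : ℝ) ^ n := by
  rw [norm_smul, Real.norm_of_nonneg (by positivity), pow_succ]
  have h1 := norm_vertex_le i
  have h2 : (0 : ℝ) < (1 / 2 : ℝ) ^ n := by positivity
  nlinarith [norm_nonneg (vertex i)]

theorem summable_term (ω : ℕ → Fin 3) :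
    Summable fun n => (1 / 2 : ℝ) ^ (n + 1) • vertex (ω n) :=
  Summable.of_norm_bounded summable_geometric_two fun n => norm_term_le n (ω n)

theorem addressPoint_push (i : Fin 3) (ω : ℕ → Fin 3) :
    addressPoint (push i ω) = (1 / 2 : ℝ) • (addressPoint ω + vertex i) := by
  unfold addressPoint
  rw [(summable_term (push i ω)).tsum_eq_zero_add, smul_add, ← (summable_term ω).tsum_const_smul,
    add_comm]
  congr 1
  · refine tsum_congr fun n => ?_
    rw [smul_smul, push, pow_succ' _ (n + 1)]
  · simp [push]

/-- The contraction `F_i x = (x + q_i) / 2` of the gasket into itself. -/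
def F (i : Fin 3) (x : SG) : SG :=
  ⟨(1 / 2 : ℝ) • (x.1 + vertex i), by
    obtain ⟨_, ω, rfl⟩ := x
    exact ⟨push i ω, addressPoint_push i ω⟩⟩

/-- The composition `F_w = F_{w₁} ∘ F_{w₂} ∘ ⋯` along a word `w`. -/
def Fw (w : List (Fin 3)) (x : SG) : SG := w.foldr F x

theorem addressPoint_const (i : Fin 3) : addressPoint (fun _ => i) = vertex i := by
  have h := addressPoint_push i fun _ => i
  have h' : push i (fun _ => i) = fun _ => i := by
    funext n; cases n <;> rfl
  rw [h'] at h
  have h2 := congrArg (fun z => (2 : ℝ) • z) h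
  simp only [smul_smul] at h2
  norm_num [two_smul] at h2
  exact h2

/-- The boundary points `q_0, q_1, q_2` of the gasket. -/
def q (i : Fin 3) : SG := ⟨vertex i, fun _ => i, addressPoint_const i⟩

/-- The vertices `V_m` of the level `m` graph approximation; `V 0` is the boundary. -/
def V (m : ℕ) : Set SG := {x | ∃ (w : Fin m → Fin 3) (i : Fin 3), x = Fw (List.ofFn w) (q i)}

/-- The standard self-similar probability measure on the gasket: every cell `F_w SG` with
`|w| = m` has measure `3⁻ᵐ`. It is the law of the point whose address has independent letters
that are uniform on `{0, 1, 2}`. -/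
def μ : Measure SG :=
  (Measure.infinitePi fun _ : ℕ => (PMF.uniformOfFintype (Fin 3)).toMeasure).map code

/-! ## Energy and Laplacian -/

/-- The renormalized graph energy of level `m`: the sum over the edges of the level `m` graph,
which are the sides `{F_w q_i, F_w q_j}` of the cells of level `m`. -/
def graphEnergy (m : ℕ) (u v : SG → ℝ) : ℝ :=
  (5 / 3 : ℝ) ^ m * ∑ w : Fin m → Fin 3, ∑ i : Fin 3, ∑ j ∈ Finset.Ioi i,
    (u (Fw (List.ofFn w) (q i)) - u (Fw (List.ofFn w) (q j))) *
      (v (Fw (List.ofFn w) (q i)) - v (Fw (List.ofFn w) (q j)))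

/-- The domain of the energy: the continuous functions of finite energy. (The graph energies
`graphEnergy m u u` are nondecreasing in `m`.) -/
def domE : Set (SG → ℝ) :=
  {u | Continuous u ∧ BddAbove (Set.range fun m => graphEnergy m u u)}

/-- The functions of finite energy that vanish on the boundary. -/
def domE₀ : Set (SG → ℝ) := {u | u ∈ domE ∧ ∀ x ∈ V 0, u x = 0}

/-- The energy form `ℰ(u, v)`; the limit exists for `u` and `v` in `domE`. -/
def energy (u v : SG → ℝ) : ℝ := limUnder atTop fun m => graphEnergy m u v

/-- `u ∈ dom_{L²} Δ` with `Δ u = f`. -/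
def IsLaplacian (u : SG → ℝ) (f : Lp ℝ 2 μ) : Prop :=
  u ∈ domE ∧ ∀ v ∈ domE₀, energy u v = -∫ x, f x * v x ∂μ

/-- The domain of the `L²` Laplacian with respect to `μ`. -/
def domLaplacian : Set (SG → ℝ) := {u | ∃ f, IsLaplacian u f}

open Classical in
/-- The Laplacian of a function in `domLaplacian` (and `0` for other functions). -/
def laplacian (u : SG → ℝ) : Lp ℝ 2 μ := if h : ∃ f, IsLaplacian u f then h.choose else 0

/-- The functional `T_μ(u) = ∫ |Δ u|² dμ`. -/
def T (u : SG → ℝ) : ℝ := ∫ x, laplacian u x ^ 2 ∂μ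

/-! ## Piecewise harmonic functions -/

/-- `u` is harmonic on every cell of level `m`: on each smaller cell its values at the midpoints
are given by the harmonic extension algorithm. -/
def IsPiecewiseHarmonic (m : ℕ) (u : SG → ℝ) : Prop :=
  Continuous u ∧ ∀ w : List (Fin 3), m ≤ w.length → ∀ i j k : Fin 3, i ≠ j → j ≠ k → i ≠ k →
    u (Fw w (F i (q j))) =
      2 / 5 * u (Fw w (q i)) + 2 / 5 * u (Fw w (q j)) + 1 / 5 * u (Fw w (q k))

/-! The following facts are used to show that the tent functions exist. -/

theorem F_code (i : Fin 3) (ω : ℕ → Fin 3) : F i (code ω) = code (push i ω) :=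
  Subtype.ext (addressPoint_push i ω).symm

theorem code_const (i : Fin 3) : code (fun _ => i) = q i :=
  Subtype.ext (addressPoint_const i)

theorem F_q_self (i : Fin 3) : F i (q i) = q i := by
  rw [← code_const, F_code]
  congr 1
  funext n; cases n <;> rfl

theorem F_q_comm (i j : Fin 3) : F i (q j) = F j (q i) :=
  Subtype.ext (by simp only [F, q, add_comm])

theorem F_injective (i : Fin 3) : Function.Injective (F i) := by
  intro x y h
  have h' := congrArg Subtype.val h
  simp only [F] at h'
  exact Subtype.ext (add_right_cancel (smul_right_injective _ (by norm_num : (1 / 2 : ℝ) ≠ 0) h'))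

theorem Fw_injective (w : List (Fin 3)) : Function.Injective (Fw w) := by
  induction w with
  | nil => exact fun x y h => h
  | cons i w ih => exact fun x y h => ih (F_injective i h)

theorem Fw_append (w w' : List (Fin 3)) (x : SG) : Fw (w ++ w') x = Fw w (Fw w' x) := by
  simp [Fw]

theorem continuous_code : Continuous code := by
  refine Continuous.subtype_mk ?_ _
  refine continuous_tsum (u := fun n => (1 / 2 : ℝ) ^ n) (fun n => ?_) summable_geometric_two
    fun n ω => norm_term_le n (ω n)
  exact (continuous_of_discreteTopology (f := fun i : Fin 3 =>
    (1 / 2 : ℝ) ^ (n + 1) • vertex i)).comp (continuous_apply n)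

theorem surjective_code : Function.Surjective code := by
  rintro ⟨_, ω, rfl⟩
  exact ⟨ω, rfl⟩

theorem isQuotientMap_code : IsQuotientMap code :=
  (continuous_code.isClosedMap).isQuotientMap continuous_code surjective_code

/-- The barycentric coordinates of the plane with respect to the triangle. -/
def bary (i : Fin 3) : EuclideanSpace ℝ (Fin 2) → ℝ := fun x =>
  ![1 - x 0 - x 1 / √3, x 0 - x 1 / √3, 2 * x 1 / √3] i

theorem bary_half (i j : Fin 3) (x : EuclideanSpace ℝ (Fin 2)) :
    bary i ((1 / 2 : ℝ) • (x + vertex j)) = (bary i x + if i = j then 1 else 0) / 2 := by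
  have h3 : √3 ≠ 0 := by positivity
  fin_cases i <;> fin_cases j <;> simp [bary, vertex] <;> field_simp <;> ring

theorem continuous_bary (i : Fin 3) : Continuous (bary i) := by
  unfold bary
  fin_cases i <;> simp <;> fun_prop

/-- The address with its first `n` letters removed. -/
def tail (n : ℕ) (ω : ℕ → Fin 3) : ℕ → Fin 3 := fun k => ω (n + k)

/-- The first `n` letters of an address. -/
def prefixWord (n : ℕ) (ω : ℕ → Fin 3) : List (Fin 3) := List.ofFn fun k : Fin n => ω k

theorem prefixWord_succ (n : ℕ) (ω : ℕ → Fin 3) :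
    prefixWord (n + 1) ω = prefixWord n ω ++ [ω n] := by
  unfold prefixWord
  rw [List.ofFn_succ_last]
  simp

theorem push_tail (n : ℕ) (ω : ℕ → Fin 3) : push (ω n) (tail (n + 1) ω) = tail n ω := by
  funext k
  cases k with
  | zero => rfl
  | succ k => simp only [push, tail]; congr 1; omega

theorem Fw_prefixWord (n : ℕ) (ω : ℕ → Fin 3) :
    Fw (prefixWord n ω) (code (tail n ω)) = code ω := by
  induction n with
  | zero =>
    have : tail 0 ω = ω := by funext k; simp [tail]
    simp [prefixWord, Fw, this]
  | succ n ih =>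
    rw [prefixWord_succ, Fw_append]
    change Fw _ (F (ω n) (code _)) = _
    rw [F_code, push_tail, ih]

theorem bary_tail (j : Fin 3) (n : ℕ) (ω : ℕ → Fin 3) :
    bary j (addressPoint (tail n ω)) =
      (bary j (addressPoint (tail (n + 1) ω)) + if j = ω n then 1 else 0) / 2 := by
  rw [← push_tail n ω, addressPoint_push, bary_half]

theorem bary_bounded (j : Fin 3) : ∃ B : ℝ, ∀ ω, |bary j (addressPoint ω)| ≤ B := by
  have hc : Continuous fun ω => |bary j (code ω).1| :=
    ((continuous_bary j).comp (continuous_subtype_val.comp continuous_code)).abs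
  obtain ⟨B, hB⟩ := (isCompact_range hc).bddAbove
  exact ⟨B, fun ω => hB ⟨ω, rfl⟩⟩

theorem bary_mem (j : Fin 3) (ω : ℕ → Fin 3) :
    0 ≤ bary j (addressPoint ω) ∧ bary j (addressPoint ω) ≤ 1 := by
  obtain ⟨B, hB⟩ := bary_bounded j
  have h0 : tail 0 ω = ω := by funext k; simp [tail]
  have key : ∀ n : ℕ, ∀ ω, -(B * (1 / 2) ^ n) ≤ bary j (addressPoint ω) ∧
      bary j (addressPoint ω) ≤ 1 + B * (1 / 2) ^ n := by
    intro n
    induction n with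
    | zero =>
      intro ω
      have := abs_le.1 (hB ω)
      constructor <;> simp <;> linarith
    | succ n ih =>
      intro ω
      have h0 : tail 0 ω = ω := by funext k; simp [tail]
      have h := bary_tail j 0 ω
      rw [h0] at h
      obtain ⟨h1, h2⟩ := ih (tail (0 + 1) ω)
      rw [pow_succ]
      split_ifs at h <;> constructor <;> linarith
  have hl : Tendsto (fun n : ℕ => B * (1 / 2 : ℝ) ^ n) atTop (𝓝 0) := by
    simpa using (tendsto_pow_atTop_nhds_zero_of_lt_one (r := (1 / 2 : ℝ)) (by norm_num)
      (by norm_num)).const_mul B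
  constructor
  · exact le_of_tendsto' (by simpa using hl.neg) fun n => (key n ω).1
  · exact ge_of_tendsto' (by simpa using hl.const_add 1) fun n => (key n ω).2

theorem eq_of_bary_eq_one {j : Fin 3} {ω : ℕ → Fin 3} (h : bary j (addressPoint ω) = 1)
    (n : ℕ) : ω n = j := by
  have h0 : tail 0 ω = ω := by funext k; simp [tail]
  have key : ∀ n, bary j (addressPoint (tail n ω)) = 1 → ω n = j ∧
      bary j (addressPoint (tail (n + 1) ω)) = 1 := by
    intro n hn
    have h := bary_tail j n ω
    have h2 := (bary_mem j (tail (n + 1) ω)).2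
    by_cases hj : j = ω n
    · rw [if_pos hj] at h
      exact ⟨hj.symm, by linarith⟩
    · rw [if_neg hj] at h
      linarith
  have all : ∀ n, bary j (addressPoint (tail n ω)) = 1 := by
    intro n
    induction n with
    | zero => rw [h0]; exact h
    | succ n ih => exact (key n ih).2
  exact (key n (all n)).1

/-- Two addresses of the same point that first differ in the letter `n` are constant from then
on. -/
theorem code_eq_code {ω ω' : ℕ → Fin 3} (h : code ω = code ω') (n : ℕ)
    (hn : ∀ k < n, ω k = ω' k) (hne : ω n ≠ ω' n) (k : ℕ) : ω (n + 1 + k) = ω' n := by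
  have hp : prefixWord n ω = prefixWord n ω' := by
    simp only [prefixWord]
    congr 1
    funext k
    exact hn k k.2
  rw [← Fw_prefixWord n ω, ← Fw_prefixWord n ω', hp] at h
  have h1 := congrArg Subtype.val (Fw_injective _ h)
  have h2 := congrArg (bary (ω' n)) h1
  simp only [code] at h2
  rw [bary_tail _ n ω, bary_tail _ n ω', if_neg hne.symm, if_pos rfl] at h2
  have h3 := (bary_mem (ω' n) (tail (n + 1) ω)).2
  have h4 := (bary_mem (ω' n) (tail (n + 1) ω')).1
  exact eq_of_bary_eq_one (ω := tail (n + 1) ω) (by linarith) k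

theorem exists_continuous_of_cellData (c : List (Fin 3) → Fin 3 → ℝ) (C : ℝ)
    (h1 : ∀ w i, c (w ++ [i]) i = c w i) (h2 : ∀ w i j, c (w ++ [i]) j = c (w ++ [j]) i)
    (h3 : ∀ w i j, |c w i - c w j| ≤ C * (3 / 5) ^ w.length) :
    ∃ f : SG → ℝ, Continuous f ∧ ∀ w i, f (Fw w (q i)) = c w i := by
  have hlen : ∀ n ω, (prefixWord n ω).length = n := fun n ω => by simp [prefixWord]
  have hstep : ∀ ω n, dist (c (prefixWord n ω) 0) (c (prefixWord (n + 1) ω) 0) ≤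
      (2 * C) * (3 / 5) ^ n := by
    intro ω n
    have e1 := abs_le.1 (h3 (prefixWord n ω) 0 (ω n))
    have e2 := abs_le.1 (h3 (prefixWord (n + 1) ω) 0 (ω n))
    have e3 : c (prefixWord (n + 1) ω) (ω n) = c (prefixWord n ω) (ω n) := by
      rw [prefixWord_succ, h1]
    rw [hlen] at e1 e2
    rw [pow_succ] at e2
    have hC : 0 ≤ C * (3 / 5 : ℝ) ^ n := by linarith
    rw [Real.dist_eq, abs_le]
    constructor <;> linarith
  have hlim : ∀ ω, ∃ l, Tendsto (fun n => c (prefixWord n ω) 0) atTop (𝓝 l) := fun ω =>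
    cauchySeq_tendsto_of_complete
      (cauchySeq_of_le_geometric (3 / 5) (2 * C) (by norm_num) (hstep ω))
  choose L hL using hlim
  have hdist : ∀ ω n, dist (c (prefixWord n ω) 0) (L ω) ≤ 2 * C * (3 / 5) ^ n / (1 - 3 / 5) :=
    fun ω n => dist_le_of_le_geometric_of_tendsto (3 / 5) (2 * C) (by norm_num) (hstep ω)
      (hL ω) n
  have hgeo : ∀ D : ℝ, Tendsto (fun n : ℕ => D * (3 / 5 : ℝ) ^ n) atTop (𝓝 0) := fun D => by
    simpa using (tendsto_pow_atTop_nhds_zero_of_lt_one (r := (3 / 5 : ℝ)) (by norm_num)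
      (by norm_num)).const_mul D
  have hcont : Continuous L := by
    have hu : TendstoUniformly (fun n ω => c (prefixWord n ω) 0) L atTop := by
      rw [Metric.tendstoUniformly_iff]
      intro ε hε
      have h := (hgeo (2 * C / (1 - 3 / 5))).eventually (gt_mem_nhds hε)
      filter_upwards [h] with n hn ω
      rw [dist_comm]
      refine (hdist ω n).trans_lt (lt_of_le_of_lt (le_of_eq ?_) hn)
      ring
    refine hu.continuous (Frequently.of_forall fun n => ?_)
    have : (fun ω : ℕ → Fin 3 => c (prefixWord n ω) 0) =
        (fun w : Fin n → Fin 3 => c (List.ofFn w) 0) ∘ fun ω k => ω k := rfl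
    rw [this]
    exact continuous_of_discreteTopology.comp
      (continuous_pi fun k => continuous_apply (k : ℕ))
  have hconst : ∀ ω N j, (∀ k, ω (N + k) = j) → L ω = c (prefixWord N ω) j := by
    intro ω N j hj
    have e : ∀ k, c (prefixWord (N + k) ω) j = c (prefixWord N ω) j := by
      intro k
      induction k with
      | zero => rfl
      | succ k ih => rw [← ih, ← add_assoc, prefixWord_succ, hj k, h1]
    refine tendsto_nhds_unique ((tendsto_add_atTop_iff_nat N).2 (hL ω)) ?_
    rw [tendsto_iff_dist_tendsto_zero]
    refine squeeze_zero (fun _ => dist_nonneg) (fun k => ?_)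
      ((tendsto_add_atTop_iff_nat N).2 (hgeo C))
    have := h3 (prefixWord (N + k) ω) 0 j
    rw [hlen, e k, add_comm N k] at this
    exact this
  have hwd : ∀ ω ω', code ω = code ω' → L ω = L ω' := by
    intro ω ω' h
    by_cases hω : ω = ω'
    · rw [hω]
    have hex : ∃ n, ω n ≠ ω' n := by
      by_contra hcon
      push Not at hcon
      exact hω (funext hcon)
    classical
    obtain ⟨n, hn, hmin⟩ : ∃ n, ω n ≠ ω' n ∧ ∀ k < n, ω k = ω' k :=
      ⟨Nat.find hex, Nat.find_spec hex, fun k hk => not_not.1 (Nat.find_min hex hk)⟩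
    have t1 := code_eq_code h n hmin hn
    have t2 := code_eq_code h.symm n (fun k hk => (hmin k hk).symm) hn.symm
    have hp : prefixWord n ω = prefixWord n ω' := by
      simp only [prefixWord]
      congr 1
      funext k
      exact hmin k k.2
    rw [hconst ω (n + 1) _ t1, hconst ω' (n + 1) _ t2, prefixWord_succ, prefixWord_succ, hp, h2]
  choose s hs using surjective_code
  have hfs : ∀ ω, L (s (code ω)) = L ω := fun ω => hwd _ _ (hs _)
  refine ⟨fun x => L (s x), ?_, fun w i => ?_⟩
  · rw [isQuotientMap_code.continuous_iff]
    exact hcont.congr fun ω => (hfs ω).symm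
  · let ω : ℕ → Fin 3 := fun k => w.getD k i
    have hw : prefixWord w.length ω = w := by
      apply List.ext_getElem
      · simp [prefixWord]
      · intro k hk1 hk2
        simp [prefixWord, ω]
    have ht : ∀ k, ω (w.length + k) = i := fun k => by simp [ω]
    have hc : code ω = Fw w (q i) := by
      rw [← Fw_prefixWord w.length ω, hw, ← code_const]
      congr 2
      funext k
      exact ht k
    rw [← hc]
    change L (s (code ω)) = _
    rw [hfs, hconst ω w.length i ht, hw]

/-- The harmonic extension algorithm: the boundary values on `F_i SG` of the harmonic function
with boundary values `a`. -/
def extend (a : Fin 3 → ℝ) (i j : Fin 3) : ℝ :=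
  if j = i then a i else (a 0 + a 1 + a 2 + a i + a j) / 5

theorem extend_osc (a : Fin 3 → ℝ) (D : ℝ) (h : ∀ i j, |a i - a j| ≤ D) (k i j : Fin 3) :
    |extend a k i - extend a k j| ≤ D * (3 / 5) := by
  have h01 := abs_le.1 (h 0 1)
  have h02 := abs_le.1 (h 0 2)
  have h12 := abs_le.1 (h 1 2)
  rw [abs_le]
  fin_cases k <;> fin_cases i <;> fin_cases j <;> simp [extend] <;>
    first | linarith | (constructor <;> linarith)

open Classical in
theorem exists_tent (m : ℕ) (z : SG) : ∃ f : SG → ℝ, IsPiecewiseHarmonic m f ∧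
    ∀ x ∈ V m, f x = if x = z then 1 else 0 := by
  let b : SG → ℝ := fun x => if x = z then 1 else 0
  let c : List (Fin 3) → Fin 3 → ℝ := fun w =>
    (w.drop m).foldl extend fun j => b (Fw (w.take m) (q j))
  have hle : ∀ w : List (Fin 3), w.length ≤ m → c w = fun j => b (Fw w (q j)) := fun w hw => by
    simp only [c, List.drop_eq_nil_of_le hw, List.take_of_length_le hw, List.foldl_nil]
  have hge : ∀ (w : List (Fin 3)) i, m ≤ w.length → c (w ++ [i]) = extend (c w) i :=
    fun w i hw => by
      simp only [c, List.drop_append_of_le_length hw, List.take_append_of_le_length hw,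
        List.foldl_append, List.foldl_cons, List.foldl_nil]
  have hsnoc : ∀ (w : List (Fin 3)) (i j : Fin 3), Fw (w ++ [i]) (q j) = Fw w (F i (q j)) :=
    fun w i j => Fw_append w [i] (q j)
  have hlt : ∀ (w : List (Fin 3)) i, ¬ m ≤ w.length →
      c (w ++ [i]) = fun j => b (Fw w (F i (q j))) := fun w i hw => by
    rw [hle _ (by simp; omega)]
    simp only [hsnoc]
  have hosc : ∀ (w : List (Fin 3)) i j, |c w i - c w j| ≤ (5 / 3) ^ m * (3 / 5) ^ w.length := by
    intro w
    induction w using List.reverseRecOn with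
    | nil =>
      intro i j
      rw [hle [] (Nat.zero_le _)]
      have : (1 : ℝ) ≤ (5 / 3) ^ m := one_le_pow₀ (by norm_num)
      simp only [b, List.length_nil, pow_zero, mul_one]
      rw [abs_le]
      split_ifs <;> constructor <;> linarith
    | append_singleton w k ih =>
      intro i j
      by_cases hw : m ≤ w.length
      · rw [hge w k hw]
        refine (extend_osc _ _ ih k i j).trans (le_of_eq ?_)
        simp only [List.length_append, List.length_singleton, pow_succ]
        ring
      · rw [hlt w k hw]
        have : (1 : ℝ) ≤ (5 / 3) ^ m * (3 / 5) ^ (w ++ [k]).length := by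
          have hl : (w ++ [k]).length ≤ m := by simp; omega
          calc (1 : ℝ) = (5 / 3) ^ m * (3 / 5) ^ m := by rw [← mul_pow]; norm_num
            _ ≤ _ := by
              gcongr ?_ * ?_
              exact pow_le_pow_of_le_one (by norm_num) (by norm_num) hl
        simp only [b]
        rw [abs_le]
        split_ifs <;> constructor <;> linarith
  obtain ⟨f, hf, hfc⟩ := exists_continuous_of_cellData c ((5 / 3) ^ m)
    (fun w i => by
      by_cases hw : m ≤ w.length
      · rw [hge w i hw]; simp [extend]
      · rw [hlt w i hw, hle w (by omega)]
        simp only [F_q_self])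
    (fun w i j => by
      by_cases hw : m ≤ w.length
      · rw [hge w i hw, hge w j hw]
        by_cases hij : i = j
        · rw [hij]
        · simp only [extend, if_neg hij, if_neg (Ne.symm hij)]; ring
      · rw [hlt w i hw, hlt w j hw]
        simp only [F_q_comm i j])
    hosc
  refine ⟨f, ⟨hf, fun w hw i j k hij hjk hik => ?_⟩, ?_⟩
  · rw [← hsnoc, hfc, hfc, hfc, hfc, hge w i hw]
    simp only [extend, if_neg (Ne.symm hij)]
    fin_cases i <;> fin_cases j <;> fin_cases k <;> simp at hij hjk hik ⊢ <;> ring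
  · rintro x ⟨w, i, rfl⟩
    rw [hfc, hle _ (by simp)]

/-- The tent function `ψ_z^{(m)}`: the continuous function that is harmonic on every cell of level
`m` and on `V_m` equals `1` at `z` and `0` elsewhere. -/
def tent (m : ℕ) (z : SG) : SG → ℝ := (exists_tent m z).choose

/-! ## The Green's function -/

/-- The midpoint of the side of the cell `F_w SG` opposite to `F_w q_k`. For `|w| = m` and
`k = 0, 1, 2` these are the points of `V_{m + 1}` outside `V_m`, each listed once. -/
def midpoint (w : List (Fin 3)) (k : Fin 3) : SG := Fw w (F (k + 1) (q (k + 2)))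

/-- The Dirichlet Green's function of the gasket,
`G(x, y) = ∑_m ∑_{z, z' ∈ V_{m + 1} \ V_m} g(z, z') ψ_z^{(m + 1)}(x) ψ_{z'}^{(m + 1)}(y)`, where
`g(z, z) = (9 / 50) (3 / 5) ^ m`, `g(z, z') = (3 / 50) (3 / 5) ^ m` for distinct points of the same
cell of level `m`, and `g(z, z') = 0` otherwise. -/
def green (x y : SG) : ℝ :=
  ∑' m : ℕ, ∑ w : Fin m → Fin 3, ∑ k : Fin 3, ∑ l : Fin 3,
    (if k = l then 9 / 50 else 3 / 50) * (3 / 5 : ℝ) ^ m *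
      tent (m + 1) (midpoint (List.ofFn w) k) x * tent (m + 1) (midpoint (List.ofFn w) l) y

/-- The iterated Green's function `∫ G(x, y) G(z, y) dμ(y)`. -/
def greenIter (x z : SG) : ℝ := ∫ y, green x y * green z y ∂μ

/-- The admissible functions: `u ∈ dom_{L²} Δ` with `u = 0` on `V_0` and `u(x_i) = a_i`. -/
def admissible {n : ℕ} (x : Fin n → SG) (a : Fin n → ℝ) : Set (SG → ℝ) :=
  {u | u ∈ domLaplacian ∧ (∀ p ∈ V 0, u p = 0) ∧ ∀ i, u (x i) = a i}

end Gasket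

end

/-!
# Minimizing the `L²` norm of the Laplacian on the Sierpinski gasket

Write `P_m v` (`interp m v`) for the piecewise harmonic function of level `m` with the values of `v`
on `V m`, and `G` for the Green's function. Everything rests on the reproducing property of `G` on
the graphs: if `v` vanishes on the boundary, the energy on the graph of level `m` of the level `m`
partial sum of `G(x, ·)` against `v` is `P_m v (x)` (`graphEnergy_greenPartial`). It holds because
passing to a finer graph does not change the energy against a harmonic function, and because the
coefficients of `G` invert the energy matrix of the tent functions at the three midpoints of a cell
(`graphEnergy_greenTerm`).

On the vertices `V m` the function `G(·, y)` agrees with its partial sum. Hence for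
`u = ∫ G(·, y) f(y) dμ(y)` the energy of `u` against `v` on the graph of level `m` is `∫ (P_m v) f`,
which tends to `∫ v f`. This shows at once that `u` has finite energy and Laplacian `-f`
(`isLaplacian_greenOp`). Testing against piecewise harmonic functions, for which the energy is an
energy on a finite graph, shows that the Dirichlet problem has no other solution
(`eq_of_isLaplacian`), so the functions in the domain of the Laplacian that vanish on the boundary
are exactly the functions `greenOp f`. Moreover `f` is determined by `greenOp f`, since continuous
functions that vanish on the null set `V 0` separate `L²` (`greenOp_injective`).

The matrix is the Gram matrix of the functions `G(x_i, ·)` in `L²`. A linear relation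
`∑ c_i G(x_i, ·) = 0` in `L²` holds everywhere because `μ` charges open sets, and by the reproducing
property it gives `∑ c_i P_m v (x_i) = 0` for all `v` that vanish on the boundary. With `v` the
indicator of a small ball around `x_i` this is `c_i = 0` (`eq_zero_of_sum_green_eq_zero`).

Finally, the values at the `x_i` of `greenOp f` are the inner products of `f` with `G(x_i, ·)`, so
that the problem is to minimize the norm of `f` under finitely many linear constraints; the solution
is the element of the span of the `G(x_i, ·)` that satisfies them (`T_lt_of_mem_admissible`).
-/

noncomputable section

namespace Gasket

/-! ### Cells and vertices -/

instance : CompactSpace SG :=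
  isCompact_univ_iff.1 (surjective_code.range_eq ▸ isCompact_range continuous_code)

theorem continuous_F (i : Fin 3) : Continuous (F i) := by
  unfold F
  fun_prop

theorem continuous_Fw (w : List (Fin 3)) : Continuous (Fw w) := by
  induction w with
  | nil => exact continuous_id
  | cons i w ih => exact (continuous_F i).comp ih

theorem dist_F (i : Fin 3) (x y : SG) : dist (F i x) (F i y) = 1 / 2 * dist x y := by
  rw [Subtype.dist_eq, Subtype.dist_eq]
  simp only [F]
  rw [dist_smul₀, dist_add_right, Real.norm_of_nonneg (by norm_num)]

theorem dist_Fw (w : List (Fin 3)) (x y : SG) :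
    dist (Fw w x) (Fw w y) = (1 / 2) ^ w.length * dist x y := by
  induction w with
  | nil => simp [Fw]
  | cons i w ih =>
    change dist (F i (Fw w x)) (F i (Fw w y)) = _
    rw [dist_F, ih, List.length_cons, pow_succ']
    ring

theorem exists_eq_Fw_ofFn (m : ℕ) (x : SG) : ∃ (w : Fin m → Fin 3) (y : SG),
    x = Fw (List.ofFn w) y := by
  obtain ⟨ω, rfl⟩ := surjective_code x
  exact ⟨fun k => ω k, code (tail m ω), (Fw_prefixWord m ω).symm⟩

theorem Fw_q_mem_V (w : List (Fin 3)) (i : Fin 3) : Fw w (q i) ∈ V w.length :=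
  ⟨w.get, i, by rw [List.ofFn_get]⟩

theorem Fw_ofFn_q_mem_V {m : ℕ} (w : Fin m → Fin 3) (i : Fin 3) : Fw (List.ofFn w) (q i) ∈ V m :=
  ⟨w, i, rfl⟩

theorem q_mem_V_zero (i : Fin 3) : q i ∈ V 0 := Fw_q_mem_V [] i

theorem finite_V (m : ℕ) : (V m).Finite := by
  refine (Set.finite_range fun p : (Fin m → Fin 3) × Fin 3 => Fw (List.ofFn p.1) (q p.2)).subset ?_
  rintro _ ⟨w, i, rfl⟩
  exact ⟨(w, i), rfl⟩

theorem V_subset_succ (m : ℕ) : V m ⊆ V (m + 1) := by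
  rintro _ ⟨w, i, rfl⟩
  have h := Fw_q_mem_V (List.ofFn w ++ [i]) i
  rw [Fw_append] at h
  change Fw _ (F i (q i)) ∈ _ at h
  rw [F_q_self] at h
  simpa using h

theorem monotone_V : Monotone V := monotone_nat_of_le_succ V_subset_succ

theorem midpoint_mem_V {m : ℕ} (w : Fin m → Fin 3) (k : Fin 3) :
    midpoint (List.ofFn w) k ∈ V (m + 1) := by
  have h := Fw_q_mem_V (List.ofFn w ++ [k + 1]) (k + 2)
  rw [Fw_append] at h
  simp only [List.length_append, List.length_ofFn, List.length_singleton] at h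
  exact h

theorem ofFn_snoc {m : ℕ} (w : Fin m → Fin 3) (i : Fin 3) :
    List.ofFn (Fin.snoc w i : Fin (m + 1) → Fin 3) = List.ofFn w ++ [i] := by
  rw [List.ofFn_succ_last]
  simp

/-- The corners of the three subcells of a cell are the corners and the midpoints of the cell. -/
theorem Fw_F_q_cases (w : List (Fin 3)) (i j : Fin 3) :
    (Fw w (F i (q j)) = Fw w (q i)) ∨ ∃ k, Fw w (F i (q j)) = midpoint w k := by
  unfold midpoint
  fin_cases i <;> fin_cases j <;> simp only [Fin.zero_eta, Fin.mk_one, Fin.reduceFinMk]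
  all_goals first
    | (left; rw [F_q_self])
    | (right; first
        | exact ⟨0, rfl⟩ | exact ⟨1, rfl⟩ | exact ⟨2, rfl⟩
        | exact ⟨0, congrArg (Fw w) (F_q_comm _ _)⟩ | exact ⟨1, congrArg (Fw w) (F_q_comm _ _)⟩
        | exact ⟨2, congrArg (Fw w) (F_q_comm _ _)⟩)

theorem mem_V_succ_iff {m : ℕ} {x : SG} (hx : x ∈ V (m + 1)) :
    x ∈ V m ∨ ∃ (w : Fin m → Fin 3) (k : Fin 3), x = midpoint (List.ofFn w) k := by
  obtain ⟨w, j, rfl⟩ := hx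
  induction w using Fin.snocCases with
  | snoc w i =>
    rw [ofFn_snoc, Fw_append]
    change Fw _ (F i (q j)) ∈ V m ∨ ∃ w' k, Fw _ (F i (q j)) = _
    rcases Fw_F_q_cases (List.ofFn w) i j with h | ⟨k, h⟩
    · exact Or.inl (h ▸ Fw_ofFn_q_mem_V w i)
    · exact Or.inr ⟨w, k, h⟩

theorem eq_of_foldr_push_eq {w : List (Fin 3)} {ω : ℕ → Fin 3} {c : Fin 3}
    (h : ∀ k, w.foldr push ω k = c) (k : ℕ) : ω k = c := by
  induction w with
  | nil => exact h k
  | cons i w ih => exact ih fun k => h (k + 1)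

theorem code_foldr_push (w : List (Fin 3)) (ω : ℕ → Fin 3) :
    code (w.foldr push ω) = Fw w (code ω) := by
  induction w with
  | nil => rfl
  | cons i w ih => exact (F_code i _).symm.trans (congrArg (F i) ih)

/-- Two distinct cells of the same level share at most corners, and a corner has a constant
address in the cell. A point with an address in the cell that begins with two different letters
therefore determines the cell. -/
theorem Fw_code_inj {w w' : List (Fin 3)} (hw : w.length = w'.length)
    {ω ω' : ℕ → Fin 3} (hω : ω 0 ≠ ω 1) (h : Fw w (code ω) = Fw w' (code ω')) :
    w = w' ∧ code ω = code ω' := by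
  induction w generalizing w' with
  | nil =>
    obtain rfl := List.length_eq_zero_iff.1 hw.symm
    exact ⟨rfl, h⟩
  | cons i w ih =>
    cases w' with
    | nil => simp at hw
    | cons j w' =>
      by_cases hij : i = j
      · subst hij
        obtain ⟨h1, h2⟩ := ih (by simpa using hw) (F_injective i h)
        exact ⟨by rw [h1], h2⟩
      · rw [← code_foldr_push, ← code_foldr_push] at h
        have hc := code_eq_code h 0 (by simp) hij
        have hc' : ∀ k, w.foldr push ω k = j := fun k => by
          have := hc k
          rw [zero_add, add_comm] at this
          exact this
        exact absurd ((eq_of_foldr_push_eq hc' 0).trans (eq_of_foldr_push_eq hc' 1).symm) hω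

theorem bary_q (i j : Fin 3) : bary i (q j).1 = if i = j then 1 else 0 := by
  have h := bary_half i j (vertex j)
  have h2 : (1 / 2 : ℝ) • (vertex j + vertex j) = vertex j := by
    rw [← two_smul ℝ, smul_smul]; norm_num
  rw [h2] at h
  change bary i (vertex j) = _
  linarith

theorem midpoint_eq_Fw_code (w : List (Fin 3)) (k : Fin 3) :
    midpoint w k = Fw w (code (push (k + 1) fun _ => k + 2)) := by
  rw [← F_code, code_const, midpoint]

theorem F_q_succ_inj {k l : Fin 3} (h : F (k + 1) (q (k + 2)) = F (l + 1) (q (l + 2))) :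
    k = l := by
  have h1 := congrArg (fun x : SG => bary k x.1) h
  simp only [F, bary_half, bary_q] at h1
  fin_cases k <;> fin_cases l <;> simp at h1 ⊢

theorem midpoint_inj {w w' : List (Fin 3)} (hw : w.length = w'.length) {k l : Fin 3}
    (h : midpoint w k = midpoint w' l) : w = w' ∧ k = l := by
  rw [midpoint_eq_Fw_code, midpoint_eq_Fw_code] at h
  obtain ⟨h1, h2⟩ := Fw_code_inj hw (by simp [push]) h
  rw [← F_code, ← F_code, code_const, code_const] at h2
  exact ⟨h1, F_q_succ_inj h2⟩

theorem midpoint_notMem_V {m : ℕ} (w : Fin m → Fin 3) (k : Fin 3) :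
    midpoint (List.ofFn w) k ∉ V m := by
  rintro ⟨w', i, h⟩
  rw [midpoint_eq_Fw_code, ← code_const] at h
  obtain ⟨-, h2⟩ := Fw_code_inj (by simp) (by simp [push]) h
  rw [← F_code, code_const, code_const] at h2
  have h1 := congrArg (fun x : SG => bary i x.1) h2
  simp only [F, bary_half, bary_q] at h1
  fin_cases k <;> fin_cases i <;> simp at h1

/-! ### Piecewise harmonic functions -/

theorem IsPiecewiseHarmonic.mono {m n : ℕ} {h : SG → ℝ} (hh : IsPiecewiseHarmonic m h)
    (hmn : m ≤ n) : IsPiecewiseHarmonic n h :=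
  ⟨hh.1, fun w hw => hh.2 w (hmn.trans hw)⟩

theorem IsPiecewiseHarmonic.sum {m : ℕ} {ι : Type*} (s : Finset ι) (c : ι → ℝ)
    {h : ι → SG → ℝ} (hh : ∀ a ∈ s, IsPiecewiseHarmonic m (h a)) :
    IsPiecewiseHarmonic m fun x => ∑ a ∈ s, c a * h a x := by
  refine ⟨continuous_finsetSum s fun a ha => continuous_const.mul (hh a ha).1,
    fun w hw i j k hij hjk hik => ?_⟩
  simp only [Finset.mul_sum, ← Finset.sum_add_distrib]
  refine Finset.sum_congr rfl fun a ha => ?_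
  rw [(hh a ha).2 w hw i j k hij hjk hik]
  ring

theorem IsPiecewiseHarmonic.sub {m : ℕ} {g h : SG → ℝ} (hg : IsPiecewiseHarmonic m g)
    (hh : IsPiecewiseHarmonic m h) : IsPiecewiseHarmonic m fun x => g x - h x := by
  refine ⟨hg.1.sub hh.1, fun w hw i j k hij hjk hik => ?_⟩
  beta_reduce
  rw [hg.2 w hw i j k hij hjk hik, hh.2 w hw i j k hij hjk hik]
  ring

theorem exists_ne_ne (i j : Fin 3) (hij : i ≠ j) : ∃ k, j ≠ k ∧ i ≠ k := by
  revert i j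
  decide

theorem tendsto_cellSize :
    Tendsto (fun n : ℕ => (1 / 2 : ℝ) ^ n * Metric.diam (Set.univ : Set SG)) atTop (𝓝 0) := by
  simpa using (tendsto_pow_atTop_nhds_zero_of_lt_one (r := (1 / 2 : ℝ)) (by norm_num)
    (by norm_num)).mul_const (Metric.diam (Set.univ : Set SG))

theorem tendsto_prefixWord (ω : ℕ → Fin 3) (i : Fin 3) :
    Tendsto (fun n => Fw (prefixWord n ω) (q i)) atTop (𝓝 (code ω)) := by
  rw [tendsto_iff_dist_tendsto_zero]
  refine squeeze_zero (fun _ => dist_nonneg) (fun n => ?_) tendsto_cellSize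
  have hl : (prefixWord n ω).length = n := by simp [prefixWord]
  rw [← Fw_prefixWord n ω]
  rw [dist_Fw, hl]
  gcongr
  exact Metric.dist_le_diam_of_mem isCompact_univ.isBounded trivial trivial

/-- The maximum principle: on a cell, a harmonic function lies between the extreme values at the
corners. -/
theorem IsPiecewiseHarmonic.mem_Icc {m : ℕ} {h : SG → ℝ} (hh : IsPiecewiseHarmonic m h)
    {w : List (Fin 3)} (hw : m ≤ w.length) {a b : ℝ}
    (hab : ∀ i, h (Fw w (q i)) ∈ Set.Icc a b) (x : SG) : h (Fw w x) ∈ Set.Icc a b := by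
  have key : ∀ (w' : List (Fin 3)) i, h (Fw (w ++ w') (q i)) ∈ Set.Icc a b := by
    intro w'
    induction w' using List.reverseRecOn with
    | nil => simpa using hab
    | append_singleton w' i ih =>
      intro j
      rw [← List.append_assoc, Fw_append]
      change h (Fw _ (F i (q j))) ∈ _
      by_cases hij : i = j
      · rw [hij, F_q_self]
        exact ih j
      · obtain ⟨k, hjk, hik⟩ := exists_ne_ne i j hij
        rw [hh.2 _ (by simp; omega) i j k hij hjk hik]
        have hi := ih i
        have hj := ih j
        have hk := ih k
        simp only [Set.mem_Icc] at hi hj hk ⊢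
        constructor <;> linarith
  obtain ⟨ω, rfl⟩ := surjective_code x
  have hlim := ((hh.1.comp (continuous_Fw w)).tendsto (code ω)).comp (tendsto_prefixWord ω 0)
  refine isClosed_Icc.mem_of_tendsto hlim (Eventually.of_forall fun n => ?_)
  simp only [Function.comp_apply, ← Fw_append]
  exact key _ 0

theorem IsPiecewiseHarmonic.mem_Icc_of_V {m : ℕ} {h : SG → ℝ} (hh : IsPiecewiseHarmonic m h)
    {a b : ℝ} (hab : ∀ z ∈ V m, h z ∈ Set.Icc a b) (x : SG) : h x ∈ Set.Icc a b := by
  obtain ⟨w, y, rfl⟩ := exists_eq_Fw_ofFn m x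
  exact hh.mem_Icc (by simp) (fun i => hab _ (Fw_ofFn_q_mem_V w i)) y

theorem IsPiecewiseHarmonic.ext {m : ℕ} {g h : SG → ℝ} (hg : IsPiecewiseHarmonic m g)
    (hh : IsPiecewiseHarmonic m h) (heq : ∀ z ∈ V m, g z = h z) : g = h := by
  funext x
  have := (hg.sub hh).mem_Icc_of_V (a := 0) (b := 0) (fun z hz => by simp [heq z hz]) x
  rw [Set.Icc_self, Set.mem_singleton_iff] at this
  linarith

theorem tent_harmonic (m : ℕ) (z : SG) : IsPiecewiseHarmonic m (tent m z) :=
  (exists_tent m z).choose_spec.1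

open Classical in
theorem tent_apply {m : ℕ} (z : SG) {x : SG} (hx : x ∈ V m) :
    tent m z x = if x = z then 1 else 0 := by
  have := (exists_tent m z).choose_spec.2 x hx
  simpa only [tent] using this

theorem continuous_tent (m : ℕ) (z : SG) : Continuous (tent m z) := (tent_harmonic m z).1

theorem tent_nonneg (m : ℕ) (z x : SG) : 0 ≤ tent m z x := by
  classical
  refine ((tent_harmonic m z).mem_Icc_of_V (a := 0) (b := 1) (fun y hy => ?_) x).1
  rw [tent_apply z hy]
  split_ifs <;> simp

/-- The piecewise harmonic function of level `m` with the same values as `v` on `V m`. -/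
def interp (m : ℕ) (v : SG → ℝ) (x : SG) : ℝ := ∑ z ∈ (finite_V m).toFinset, v z * tent m z x

theorem interp_harmonic (m : ℕ) (v : SG → ℝ) : IsPiecewiseHarmonic m (interp m v) :=
  IsPiecewiseHarmonic.sum _ v fun z _ => tent_harmonic m z

theorem interp_apply {m : ℕ} (v : SG → ℝ) {x : SG} (hx : x ∈ V m) : interp m v x = v x := by
  classical
  unfold interp
  rw [Finset.sum_eq_single x]
  · rw [tent_apply x hx, if_pos rfl, mul_one]
  · intro z _ hz
    rw [tent_apply z hx, if_neg hz.symm, mul_zero]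
  · intro h
    exact absurd ((finite_V m).mem_toFinset.2 hx) h

theorem continuous_interp (m : ℕ) (v : SG → ℝ) : Continuous (interp m v) :=
  (interp_harmonic m v).1

/-- The value of `interp m v` at `x` depends only on the values of `v` near `x`. -/
theorem interp_mem_Icc {m : ℕ} {v : SG → ℝ} {x : SG} {a b : ℝ}
    (h : ∀ z, dist z x ≤ (1 / 2) ^ m * Metric.diam (Set.univ : Set SG) → v z ∈ Set.Icc a b) :
    interp m v x ∈ Set.Icc a b := by
  obtain ⟨w, y, rfl⟩ := exists_eq_Fw_ofFn m x
  refine (interp_harmonic m v).mem_Icc (by simp) (fun i => ?_) y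
  rw [interp_apply v (Fw_ofFn_q_mem_V w i)]
  refine h _ ?_
  rw [dist_Fw, List.length_ofFn]
  gcongr
  exact Metric.dist_le_diam_of_mem isCompact_univ.isBounded trivial trivial

theorem tendsto_interp {v : SG → ℝ} (hv : Continuous v) (x : SG) :
    Tendsto (fun n => interp n v x) atTop (𝓝 (v x)) := by
  rw [Metric.tendsto_nhds]
  intro ε hε
  obtain ⟨δ, hδ, hδv⟩ := Metric.continuous_iff.1 hv x (ε / 2) (half_pos hε)
  filter_upwards [tendsto_cellSize.eventually (gt_mem_nhds hδ)] with n hn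
  have := interp_mem_Icc (m := n) (v := v) (x := x) (a := v x - ε / 2) (b := v x + ε / 2)
    fun z hz => by
      have := abs_lt.1 (hδv z (hz.trans_lt hn))
      constructor <;> linarith
  rw [Real.dist_eq, abs_lt]
  constructor <;> linarith [this.1, this.2]

theorem abs_interp_le {v : SG → ℝ} {B : ℝ} (hB : ∀ x, |v x| ≤ B) (n : ℕ) (x : SG) :
    |interp n v x| ≤ B :=
  abs_le.2 (interp_mem_Icc fun z _ => abs_le.1 (hB z))

/-! ### Graph energies -/

/-- The energy form of one triangle, in terms of the values at its corners. -/
def cellEnergy (a b : Fin 3 → ℝ) : ℝ :=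
  (a 0 - a 1) * (b 0 - b 1) + (a 0 - a 2) * (b 0 - b 2) + (a 1 - a 2) * (b 1 - b 2)

theorem sum_edges_eq_cellEnergy (a b : Fin 3 → ℝ) :
    ∑ i : Fin 3, ∑ j ∈ Finset.Ioi i, (a i - a j) * (b i - b j) = cellEnergy a b := by
  have h0 : Finset.Ioi (0 : Fin 3) = {1, 2} := by decide
  have h1 : Finset.Ioi (1 : Fin 3) = {2} := by decide
  have h2 : Finset.Ioi (2 : Fin 3) = ∅ := by decide
  rw [Fin.sum_univ_three, h0, h1, h2]
  simp [cellEnergy]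

theorem graphEnergy_eq (m : ℕ) (u v : SG → ℝ) :
    graphEnergy m u v = (5 / 3 : ℝ) ^ m * ∑ w : Fin m → Fin 3,
      cellEnergy (fun i => u (Fw (List.ofFn w) (q i))) fun i => v (Fw (List.ofFn w) (q i)) := by
  simp only [graphEnergy, ← sum_edges_eq_cellEnergy]

/-- The energy of the three subcells of a cell, where `a` and `b` are the values at the corners of
the cell, and `s k` and `t k` are the values at the midpoint opposite to the corner `k`. -/
def splitEnergy (a s b t : Fin 3 → ℝ) : ℝ :=
  cellEnergy ![a 0, s 2, s 1] ![b 0, t 2, t 1] + cellEnergy ![s 2, a 1, s 0] ![t 2, b 1, t 0] +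
    cellEnergy ![s 1, s 0, a 2] ![t 1, t 0, b 2]

theorem subcell_values (u : SG → ℝ) (w : List (Fin 3)) :
    (fun j => u (Fw w (F 0 (q j)))) = ![u (Fw w (q 0)), u (midpoint w 2), u (midpoint w 1)] ∧
    (fun j => u (Fw w (F 1 (q j)))) = ![u (midpoint w 2), u (Fw w (q 1)), u (midpoint w 0)] ∧
    (fun j => u (Fw w (F 2 (q j)))) = ![u (midpoint w 1), u (midpoint w 0), u (Fw w (q 2))] := by
  have e0 : midpoint w 0 = Fw w (F 1 (q 2)) := rfl
  have e1 : midpoint w 1 = Fw w (F 2 (q 0)) := rfl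
  have e2 : midpoint w 2 = Fw w (F 0 (q 1)) := rfl
  rw [e0, e1, e2]
  refine ⟨?_, ?_, ?_⟩ <;> funext j <;> fin_cases j <;>
    simp [F_q_self, F_q_comm 0 2, F_q_comm 1 0, F_q_comm 2 1]

theorem graphEnergy_succ (m : ℕ) (u v : SG → ℝ) :
    graphEnergy (m + 1) u v = (5 / 3 : ℝ) ^ (m + 1) * ∑ w : Fin m → Fin 3,
      splitEnergy (fun i => u (Fw (List.ofFn w) (q i))) (fun k => u (midpoint (List.ofFn w) k))
        (fun i => v (Fw (List.ofFn w) (q i))) fun k => v (midpoint (List.ofFn w) k) := by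
  rw [graphEnergy_eq]
  congr 1
  rw [← (Fin.snocEquiv fun _ => Fin 3).sum_comp, Fintype.sum_prod_type_right]
  refine Finset.sum_congr rfl fun w _ => ?_
  have e : ∀ i : Fin 3, List.ofFn (Fin.snocEquiv (fun _ => Fin 3) (i, w)) = List.ofFn w ++ [i] :=
    fun i => ofFn_snoc w i
  simp only [e, Fw_append]
  have hu := subcell_values u (List.ofFn w)
  have hv := subcell_values v (List.ofFn w)
  rw [Fin.sum_univ_three]
  change cellEnergy (fun j => u (Fw _ (F 0 (q j)))) (fun j => v (Fw _ (F 0 (q j)))) +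
    cellEnergy (fun j => u (Fw _ (F 1 (q j)))) (fun j => v (Fw _ (F 1 (q j)))) +
    cellEnergy (fun j => u (Fw _ (F 2 (q j)))) (fun j => v (Fw _ (F 2 (q j)))) = _
  rw [hu.1, hu.2.1, hu.2.2, hv.1, hv.2.1, hv.2.2, splitEnergy]

theorem IsPiecewiseHarmonic.apply_midpoint {m : ℕ} {h : SG → ℝ} (hh : IsPiecewiseHarmonic m h)
    {w : List (Fin 3)} (hw : m ≤ w.length) (k : Fin 3) :
    h (midpoint w k) = 2 / 5 * h (Fw w (q (k + 1))) + 2 / 5 * h (Fw w (q (k + 2))) +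
      1 / 5 * h (Fw w (q k)) :=
  hh.2 w hw (k + 1) (k + 2) k (by simp) (by simp) (by simp)

theorem graphEnergy_comm (m : ℕ) (u v : SG → ℝ) : graphEnergy m u v = graphEnergy m v u := by
  simp only [graphEnergy_eq, cellEnergy, mul_comm]

theorem graphEnergy_add_left (m : ℕ) (u u' v : SG → ℝ) :
    graphEnergy m (fun x => u x + u' x) v = graphEnergy m u v + graphEnergy m u' v := by
  simp only [graphEnergy_eq, ← mul_add, ← Finset.sum_add_distrib]
  congr 1
  refine Finset.sum_congr rfl fun w _ => ?_
  simp only [cellEnergy]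
  ring

theorem graphEnergy_sub_left (m : ℕ) (u u' v : SG → ℝ) :
    graphEnergy m (fun x => u x - u' x) v = graphEnergy m u v - graphEnergy m u' v := by
  simp only [graphEnergy_eq, ← mul_sub, ← Finset.sum_sub_distrib]
  congr 1
  refine Finset.sum_congr rfl fun w _ => ?_
  simp only [cellEnergy]
  ring

theorem graphEnergy_mul_left (m : ℕ) (c : ℝ) (u v : SG → ℝ) :
    graphEnergy m (fun x => u x * c) v = graphEnergy m u v * c := by
  rw [graphEnergy_eq, graphEnergy_eq, mul_assoc, Finset.sum_mul]
  congr 1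
  refine Finset.sum_congr rfl fun w _ => ?_
  simp only [cellEnergy]
  ring

theorem graphEnergy_congr {m : ℕ} {u u' v v' : SG → ℝ} (hu : ∀ z ∈ V m, u z = u' z)
    (hv : ∀ z ∈ V m, v z = v' z) : graphEnergy m u v = graphEnergy m u' v' := by
  simp only [graphEnergy_eq, hu _ (Fw_ofFn_q_mem_V _ _), hv _ (Fw_ofFn_q_mem_V _ _)]

/-- Passing to the next graph does not change the energy against a harmonic function. The factor
`5 / 3` is chosen for this to hold. -/
theorem graphEnergy_succ_of_harmonic {m : ℕ} {h : SG → ℝ} (hh : IsPiecewiseHarmonic m h)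
    (v : SG → ℝ) : graphEnergy (m + 1) h v = graphEnergy m h v := by
  rw [graphEnergy_succ, graphEnergy_eq, pow_succ, mul_assoc]
  congr 1
  rw [Finset.mul_sum]
  refine Finset.sum_congr rfl fun w _ => ?_
  have hm : ∀ k, h (midpoint (List.ofFn w) k) = _ := hh.apply_midpoint (by simp)
  simp only [splitEnergy, cellEnergy, hm, Matrix.cons_val]
  simp only [zero_add, Fin.reduceAdd]
  ring

theorem graphEnergy_of_harmonic {m n : ℕ} (hmn : m ≤ n) {h : SG → ℝ}
    (hh : IsPiecewiseHarmonic m h) (v : SG → ℝ) : graphEnergy n h v = graphEnergy m h v := by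
  induction n, hmn using Nat.le_induction with
  | base => rfl
  | succ n hmn ih => rw [graphEnergy_succ_of_harmonic (hh.mono hmn), ih]

theorem IsPiecewiseHarmonic.mem_domE {m : ℕ} {h : SG → ℝ} (hh : IsPiecewiseHarmonic m h) :
    h ∈ domE := by
  refine ⟨hh.1, ((tendsto_const_nhds (x := graphEnergy m h h)).congr' ?_).bddAbove_range⟩
  filter_upwards [eventually_ge_atTop m] with n hn
  exact (graphEnergy_of_harmonic hn hh h).symm

theorem energy_of_harmonic {m : ℕ} {h : SG → ℝ} (hh : IsPiecewiseHarmonic m h) (u : SG → ℝ) :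
    energy u h = graphEnergy m u h := by
  refine Tendsto.limUnder_eq (tendsto_const_nhds.congr' ?_)
  filter_upwards [eventually_ge_atTop m] with n hn
  rw [graphEnergy_comm n, graphEnergy_of_harmonic hn hh, graphEnergy_comm]

/-- A continuous function that vanishes on the boundary and has energy zero on every graph is zero:
it is constant on the corners of each cell, and each subcell shares a corner with its cell. -/
theorem eq_zero_of_graphEnergy_eq_zero {u : SG → ℝ} (hc : Continuous u)
    (h0 : ∀ z ∈ V 0, u z = 0) (hu : ∀ m, graphEnergy m u u = 0) : u = 0 := by
  have hcell : ∀ {m} (w : Fin m → Fin 3) i j,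
      u (Fw (List.ofFn w) (q i)) = u (Fw (List.ofFn w) (q j)) := by
    intro m w
    have hnn : ∀ a : Fin 3 → ℝ, 0 ≤ cellEnergy a a := fun a => by
      unfold cellEnergy
      nlinarith [mul_self_nonneg (a 0 - a 1), mul_self_nonneg (a 0 - a 2),
        mul_self_nonneg (a 1 - a 2)]
    have hm := hu m
    rw [graphEnergy_eq, mul_eq_zero, or_iff_right (by positivity),
      Finset.sum_eq_zero_iff_of_nonneg fun w _ => hnn _] at hm
    have h := hm w (Finset.mem_univ w)
    simp only [cellEnergy] at h
    have h01 := mul_self_nonneg (u (Fw (List.ofFn w) (q 0)) - u (Fw (List.ofFn w) (q 1)))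
    have h02 := mul_self_nonneg (u (Fw (List.ofFn w) (q 0)) - u (Fw (List.ofFn w) (q 2)))
    have h12 := mul_self_nonneg (u (Fw (List.ofFn w) (q 1)) - u (Fw (List.ofFn w) (q 2)))
    have e1 := sub_eq_zero.1 (mul_self_eq_zero.1 (by linarith :
      (u (Fw (List.ofFn w) (q 0)) - u (Fw (List.ofFn w) (q 1))) *
        (u (Fw (List.ofFn w) (q 0)) - u (Fw (List.ofFn w) (q 1))) = 0))
    have e2 := sub_eq_zero.1 (mul_self_eq_zero.1 (by linarith :
      (u (Fw (List.ofFn w) (q 0)) - u (Fw (List.ofFn w) (q 2))) *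
        (u (Fw (List.ofFn w) (q 0)) - u (Fw (List.ofFn w) (q 2))) = 0))
    have all : ∀ i, u (Fw (List.ofFn w) (q i)) = u (Fw (List.ofFn w) (q 0)) := by
      intro i
      fin_cases i
      exacts [rfl, e1.symm, e2.symm]
    intro i j
    rw [all i, all j]
  have hV : ∀ m, ∀ (w : Fin m → Fin 3) i, u (Fw (List.ofFn w) (q i)) = 0 := by
    intro m
    induction m with
    | zero => exact fun w i => h0 _ (Fw_ofFn_q_mem_V w i)
    | succ m ih =>
      intro w j
      induction w using Fin.snocCases with
      | snoc w i =>
        rw [hcell _ j i, ofFn_snoc, Fw_append]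
        change u (Fw _ (F i (q i))) = 0
        rw [F_q_self, ih]
  funext x
  obtain ⟨ω, rfl⟩ := surjective_code x
  refine tendsto_nhds_unique ((hc.tendsto _).comp (tendsto_prefixWord ω 0)) ?_
  refine tendsto_const_nhds.congr fun n => ?_
  exact (hV n _ 0).symm

/-! ### The Green's function on the graphs -/

/-- The summand of level `m` of the Green's function. -/
def greenTerm (m : ℕ) (x y : SG) : ℝ :=
  ∑ w : Fin m → Fin 3, ∑ k : Fin 3, ∑ l : Fin 3,
    (if k = l then 9 / 50 else 3 / 50) * (3 / 5 : ℝ) ^ m *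
      tent (m + 1) (midpoint (List.ofFn w) k) x * tent (m + 1) (midpoint (List.ofFn w) l) y

theorem greenTerm_comm (m : ℕ) (x y : SG) : greenTerm m x y = greenTerm m y x := by
  unfold greenTerm
  refine Finset.sum_congr rfl fun w _ => ?_
  rw [Finset.sum_comm]
  refine Finset.sum_congr rfl fun k _ => Finset.sum_congr rfl fun l _ => ?_
  simp only [eq_comm (a := l)]
  ring

theorem greenTerm_harmonic (m : ℕ) (x : SG) : IsPiecewiseHarmonic (m + 1) (greenTerm m x) := by
  have h : greenTerm m x = fun y => ∑ w : Fin m → Fin 3, 1 * ∑ k : Fin 3, 1 * ∑ l : Fin 3,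
      ((if k = l then 9 / 50 else 3 / 50) * (3 / 5 : ℝ) ^ m *
        tent (m + 1) (midpoint (List.ofFn w) k) x) *
          tent (m + 1) (midpoint (List.ofFn w) l) y := by
    funext y
    simp only [greenTerm, one_mul]
  rw [h]
  exact .sum _ _ fun w _ => .sum _ _ fun k _ => .sum _ _ fun l _ => tent_harmonic _ _

theorem tent_midpoint_of_mem_V {m : ℕ} (w : Fin m → Fin 3) (k : Fin 3) {y : SG} (hy : y ∈ V m) :
    tent (m + 1) (midpoint (List.ofFn w) k) y = 0 := by
  classical
  rw [tent_apply _ (V_subset_succ m hy), if_neg]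
  rintro rfl
  exact midpoint_notMem_V w k hy

theorem tent_midpoint_midpoint {m : ℕ} (w w' : Fin m → Fin 3) (k l : Fin 3) :
    tent (m + 1) (midpoint (List.ofFn w) k) (midpoint (List.ofFn w') l) =
      if w' = w ∧ l = k then 1 else 0 := by
  classical
  rw [tent_apply _ (midpoint_mem_V w' l)]
  congr 1
  refine propext ⟨fun h => ?_, fun h => by rw [h.1, h.2]⟩
  obtain ⟨h1, h2⟩ := midpoint_inj (by simp) h
  exact ⟨List.ofFn_injective h1, h2⟩

theorem greenTerm_of_mem_V {m : ℕ} (x : SG) {y : SG} (hy : y ∈ V m) : greenTerm m x y = 0 := by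
  simp [greenTerm, tent_midpoint_of_mem_V _ _ hy]

theorem greenTerm_midpoint {m : ℕ} (x : SG) (w : Fin m → Fin 3) (l : Fin 3) :
    greenTerm m x (midpoint (List.ofFn w) l) = ∑ k : Fin 3,
      (if k = l then 9 / 50 else 3 / 50) * (3 / 5 : ℝ) ^ m *
        tent (m + 1) (midpoint (List.ofFn w) k) x := by
  simp only [greenTerm, tent_midpoint_midpoint]
  rw [Finset.sum_eq_single w _ (by simp)]
  · simp
  · intro w' _ hw'
    simp [hw'.symm]

/-- The values of `v` at the midpoints of level `m` exceed those of its interpolation of level `m`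
by the coefficients of `interp (m + 1) v - interp m v` in terms of the tent functions. -/
theorem interp_succ_sub_interp (m : ℕ) (v : SG → ℝ) (x : SG) :
    interp (m + 1) v x - interp m v x = ∑ w : Fin m → Fin 3, ∑ k : Fin 3,
      (v (midpoint (List.ofFn w) k) - interp m v (midpoint (List.ofFn w) k)) *
        tent (m + 1) (midpoint (List.ofFn w) k) x := by
  have h : IsPiecewiseHarmonic (m + 1) fun x => ∑ w : Fin m → Fin 3, 1 * ∑ k : Fin 3,
      (v (midpoint (List.ofFn w) k) - interp m v (midpoint (List.ofFn w) k)) *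
        tent (m + 1) (midpoint (List.ofFn w) k) x :=
    .sum _ _ fun w _ => .sum _ _ fun k _ => tent_harmonic _ _
  have h2 := congrFun ((((interp_harmonic (m + 1) v).sub
    ((interp_harmonic m v).mono m.le_succ))).ext h fun z hz => ?_) x
  · simpa only [one_mul] using h2
  · rw [interp_apply v hz]
    rcases mem_V_succ_iff hz with hz | ⟨w, k, rfl⟩
    · simp [interp_apply v hz, tent_midpoint_of_mem_V _ _ hz]
    · simp only [tent_midpoint_midpoint, one_mul]
      rw [Finset.sum_eq_single w _ (by simp)]
      · simp
      · intro w' _ hw'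
        simp [hw'.symm]

/-- The coefficients `9 / 50` and `3 / 50` form, up to the factor `(3 / 5) ^ m`, the inverse of the
energy matrix of the three midpoint tent functions of a cell. -/
theorem graphEnergy_greenTerm (m : ℕ) (x : SG) (v : SG → ℝ) :
    graphEnergy (m + 1) (greenTerm m x) v = interp (m + 1) v x - interp m v x := by
  rw [interp_succ_sub_interp, graphEnergy_succ, Finset.mul_sum]
  refine Finset.sum_congr rfl fun w _ => ?_
  have hV : ∀ i, greenTerm m x (Fw (List.ofFn w) (q i)) = 0 := fun i =>
    greenTerm_of_mem_V x (Fw_ofFn_q_mem_V w i)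
  have hI : ∀ k, interp m v (midpoint (List.ofFn w) k) = _ :=
    (interp_harmonic m v).apply_midpoint (by simp)
  have hp : (5 / 3 : ℝ) ^ (m + 1) * (3 / 5) ^ m = 5 / 3 := by
    rw [pow_succ, mul_right_comm, ← mul_pow]
    norm_num
  simp only [splitEnergy, cellEnergy, hV, hI, greenTerm_midpoint, Fin.sum_univ_three,
    interp_apply v (Fw_ofFn_q_mem_V w _), Matrix.cons_val]
  simp only [zero_add, Fin.reduceAdd, Fin.reduceEq, if_true, if_false]
  generalize (5 / 3 : ℝ) ^ (m + 1) = A at hp ⊢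
  generalize (3 / 5 : ℝ) ^ m = B at hp ⊢
  have key : ∀ L R : ℝ, L = A * B * (3 / 5 * R) → L = R := fun L R h => by rw [h, hp]; ring
  apply key
  ring

/-- The partial sum of the Green's function over the levels below `m`. -/
def greenPartial (m : ℕ) (x y : SG) : ℝ := ∑ k ∈ Finset.range m, greenTerm k x y

theorem greenPartial_harmonic (m : ℕ) (x : SG) : IsPiecewiseHarmonic m (greenPartial m x) := by
  have h : greenPartial m x = fun y => ∑ k ∈ Finset.range m, 1 * greenTerm k x y := by
    funext y
    simp only [greenPartial, one_mul]
  rw [h]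
  exact .sum _ _ fun k hk => (greenTerm_harmonic k x).mono (Finset.mem_range.1 hk)

/-- The reproducing property of the Green's function, on the graph of level `m`. -/
theorem graphEnergy_greenPartial (m : ℕ) (x : SG) {v : SG → ℝ} (hv : ∀ z ∈ V 0, v z = 0) :
    graphEnergy m (greenPartial m x) v = interp m v x := by
  induction m with
  | zero =>
    have h := (interp_harmonic 0 v).mem_Icc_of_V (a := 0) (b := 0)
      (fun z hz => by simp [interp_apply v hz, hv z hz]) x
    rw [Set.Icc_self, Set.mem_singleton_iff] at h
    rw [h]
    simp [graphEnergy, greenPartial]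
  | succ m ih =>
    have e : greenPartial (m + 1) x = fun y => greenPartial m x y + greenTerm m x y := by
      funext y
      exact Finset.sum_range_succ _ _
    rw [e, graphEnergy_add_left, graphEnergy_succ_of_harmonic (greenPartial_harmonic m x), ih,
      graphEnergy_greenTerm]
    ring

theorem green_eq_greenPartial (x : SG) {m : ℕ} {y : SG} (hy : y ∈ V m) :
    green x y = greenPartial m x y :=
  tsum_eq_sum fun k hk =>
    greenTerm_of_mem_V x (monotone_V (by simpa using hk) hy)

theorem green_comm (x y : SG) : green x y = green y x :=
  tsum_congr fun m => greenTerm_comm m x y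

/-! ### Continuity of the Green's function -/

theorem sum_tent_midpoint_le_one (m : ℕ) (x : SG) :
    ∑ w : Fin m → Fin 3, ∑ k : Fin 3, tent (m + 1) (midpoint (List.ofFn w) k) x ≤ 1 := by
  have h : IsPiecewiseHarmonic (m + 1) fun x => ∑ w : Fin m → Fin 3, 1 * ∑ k : Fin 3,
      1 * tent (m + 1) (midpoint (List.ofFn w) k) x :=
    .sum _ _ fun w _ => .sum _ _ fun k _ => tent_harmonic _ _
  simp only [one_mul] at h
  refine (h.mem_Icc_of_V (a := 0) (b := 1) (fun z hz => ?_) x).2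
  rcases mem_V_succ_iff hz with hz | ⟨w, k, rfl⟩
  · simp [tent_midpoint_of_mem_V _ _ hz]
  · simp only [tent_midpoint_midpoint]
    rw [Finset.sum_eq_single w _ (by simp)]
    · simp
    · intro w' _ hw'
      simp [hw'.symm]

theorem abs_greenTerm_le (m : ℕ) (x y : SG) : |greenTerm m x y| ≤ (3 / 5) ^ m := by
  have ht := fun (w : Fin m → Fin 3) k z => tent_nonneg (m + 1) (midpoint (List.ofFn w) k) z
  have hpos : (0 : ℝ) ≤ (3 / 5) ^ m := by positivity
  have hc : ∀ k l : Fin 3, 0 ≤ (if k = l then 9 / 50 else 3 / 50 : ℝ) ∧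
      (if k = l then 9 / 50 else 3 / 50 : ℝ) ≤ 1 := fun k l => by split_ifs <;> norm_num
  have hnn : 0 ≤ greenTerm m x y := Finset.sum_nonneg fun w _ => Finset.sum_nonneg fun k _ =>
    Finset.sum_nonneg fun l _ => mul_nonneg (mul_nonneg (mul_nonneg (hc k l).1 hpos) (ht w k x))
      (ht w l y)
  rw [abs_of_nonneg hnn]
  calc greenTerm m x y
      ≤ ∑ w : Fin m → Fin 3, ∑ k : Fin 3, (3 / 5 : ℝ) ^ m *
          tent (m + 1) (midpoint (List.ofFn w) k) x := by
        refine Finset.sum_le_sum fun w _ => Finset.sum_le_sum fun k _ => ?_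
        have h1 : ∑ l : Fin 3, tent (m + 1) (midpoint (List.ofFn w) l) y ≤ 1 :=
          (Finset.single_le_sum (f := fun w : Fin m → Fin 3 =>
            ∑ l : Fin 3, tent (m + 1) (midpoint (List.ofFn w) l) y)
            (fun w _ => Finset.sum_nonneg fun l _ => ht w l y) (Finset.mem_univ w)).trans
            (sum_tent_midpoint_le_one m y)
        calc _ ≤ ∑ l : Fin 3, (3 / 5 : ℝ) ^ m * tent (m + 1) (midpoint (List.ofFn w) k) x *
              tent (m + 1) (midpoint (List.ofFn w) l) y := by
              refine Finset.sum_le_sum fun l _ => ?_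
              refine mul_le_mul_of_nonneg_right (mul_le_mul_of_nonneg_right ?_ (ht w k x))
                (ht w l y)
              exact mul_le_of_le_one_left hpos (hc k l).2
          _ ≤ _ := by
              rw [← Finset.mul_sum]
              exact mul_le_of_le_one_right (mul_nonneg hpos (ht w k x)) h1
    _ ≤ (3 / 5) ^ m := by
        simp only [← Finset.mul_sum]
        exact mul_le_of_le_one_right hpos (sum_tent_midpoint_le_one m x)

theorem summable_greenTerm_bound : Summable fun m : ℕ => (3 / 5 : ℝ) ^ m :=
  summable_geometric_of_lt_one (by norm_num) (by norm_num)

theorem continuous_green : Continuous fun p : SG × SG => green p.1 p.2 := by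
  refine continuous_tsum (fun m => ?_) summable_greenTerm_bound fun m p =>
    abs_greenTerm_le m p.1 p.2
  refine continuous_finsetSum _ fun w _ => continuous_finsetSum _ fun k _ =>
    continuous_finsetSum _ fun l _ => ?_
  exact (continuous_const.mul ((continuous_tent _ _).comp continuous_fst)).mul
    ((continuous_tent _ _).comp continuous_snd)

theorem continuous_green_right (x : SG) : Continuous fun y => green x y := by
  have h : Continuous ((fun p : SG × SG => green p.1 p.2) ∘ fun y => (x, y)) :=
    continuous_green.comp (Continuous.prodMk_right x)
  exact h

theorem exists_abs_green_le : ∃ C : ℝ, ∀ x y, |green x y| ≤ C := by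
  obtain ⟨C, hC⟩ := (isCompact_range continuous_green.abs).bddAbove
  exact ⟨C, fun x y => hC ⟨(x, y), rfl⟩⟩

theorem green_of_mem_boundary {x : SG} (hx : x ∈ V 0) (y : SG) : green x y = 0 := by
  rw [green_comm, green_eq_greenPartial y hx]
  simp [greenPartial]

/-! ### The self-similar measure -/

instance : IsProbabilityMeasure μ :=
  Measure.isProbabilityMeasure_map continuous_code.measurable.aemeasurable

theorem uniform_singleton (i : Fin 3) :
    (PMF.uniformOfFintype (Fin 3)).toMeasure {i} = 3⁻¹ := by
  rw [PMF.toMeasure_apply_singleton _ _ (MeasurableSet.singleton i)]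
  simp

instance : μ.IsOpenPosMeasure := by
  refine ⟨fun U hU hne => ?_⟩
  rw [μ, Measure.map_apply continuous_code.measurable hU.measurableSet]
  obtain ⟨x, hx⟩ := hne
  obtain ⟨ω, rfl⟩ := surjective_code x
  obtain ⟨I, t, ht, hsub⟩ := isOpen_pi_iff.1 (hU.preimage continuous_code) ω hx
  refine (lt_of_lt_of_le ?_ (measure_mono hsub)).ne'
  rw [Measure.infinitePi_pi _ fun i _ => (Set.toFinite _).measurableSet]
  refine pos_iff_ne_zero.2 (Finset.prod_ne_zero_iff.2 fun i hi => ne_of_gt ?_)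
  refine lt_of_lt_of_le ?_ (measure_mono (Set.singleton_subset_iff.2 (ht i hi).2))
  rw [uniform_singleton]
  simp

theorem measure_boundary : μ (V 0) = 0 := by
  have hq : ∀ i, μ {q i} = 0 := by
    intro i
    rw [μ, Measure.map_apply continuous_code.measurable (MeasurableSet.singleton _)]
    have hsub : code ⁻¹' {q i} ⊆ {fun _ => i} := by
      intro ω hω
      have h := congrArg (fun x : SG => bary i x.1) (Set.mem_singleton_iff.1 hω)
      simp only [bary_q, if_true] at h
      exact funext (eq_of_bary_eq_one h)
    have hlim : Tendsto (fun n : ℕ => (3⁻¹ : ℝ≥0∞) ^ n) atTop (𝓝 0) :=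
      ENNReal.tendsto_pow_atTop_nhds_zero_of_lt_one (ENNReal.inv_lt_one.2 (by norm_num))
    refine le_antisymm (ge_of_tendsto' hlim fun n => ?_) zero_le
    have hpi : code ⁻¹' {q i} ⊆ (Finset.range n : Set ℕ).pi fun _ => {i} := fun ω hω k _ =>
      congrFun (hsub hω) k
    refine (measure_mono hpi).trans (le_of_eq ?_)
    rw [Measure.infinitePi_pi _ fun i _ => MeasurableSet.singleton _]
    simp
  have hV : V 0 ⊆ ⋃ i, {q i} := by
    rintro _ ⟨w, i, rfl⟩
    exact Set.mem_iUnion.2 ⟨i, by simp [Fw]⟩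
  exact measure_mono_null hV (measure_iUnion_null hq)

theorem integrable_of_Lp (f : Lp ℝ 2 μ) : Integrable f μ := (Lp.memLp f).integrable one_le_two

/-- Continuous functions that vanish on the boundary separate integrable functions, because the
boundary is a null set. -/
theorem ae_eq_zero_of_integral_continuous {f : SG → ℝ} (hf : Integrable f μ)
    (h : ∀ v : SG → ℝ, Continuous v → (∀ z ∈ V 0, v z = 0) → ∫ y, v y * f y ∂μ = 0) :
    f =ᵐ[μ] 0 := by
  refine ae_eq_zero_of_forall_setIntegral_isClosed_eq_zero hf fun K hK => ?_
  rw [← integral_indicator hK.measurableSet]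
  have hpos : ∀ n : ℕ, 0 < 1 / ((n : ℝ) + 1) := fun n => Nat.one_div_pos_of_nat
  have hV : IsClosed (V 0) := (finite_V 0).isClosed
  have hVne : (V 0).Nonempty := ⟨_, q_mem_V_zero 0⟩
  -- The first factor tends to the indicator of `K`, the second one to that of the complement
  -- of the boundary.
  let v : ℕ → SG → ℝ := fun n y =>
    (thickenedIndicator (hpos n) K y : ℝ) * min 1 (n * Metric.infDist y (V 0))
  have hvc : ∀ n, Continuous (v n) := fun n => by
    refine Continuous.mul (NNReal.continuous_coe.comp (thickenedIndicator (hpos n) K).continuous) ?_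
    exact continuous_const.min (continuous_const.mul (Metric.continuous_infDist_pt _))
  have hv0 : ∀ n, ∀ z ∈ V 0, v n z = 0 := fun n z hz => by
    simp [v, Metric.infDist_zero_of_mem hz]
  have hv1 : ∀ n y, |v n y| ≤ 1 := fun n y => by
    have h1 : (thickenedIndicator (hpos n) K y : ℝ) ≤ 1 := by
      exact_mod_cast thickenedIndicator_le_one (hpos n) K y
    have h2 : 0 ≤ min 1 (n * Metric.infDist y (V 0)) :=
      le_min zero_le_one (mul_nonneg n.cast_nonneg Metric.infDist_nonneg)
    rw [abs_of_nonneg (mul_nonneg (NNReal.coe_nonneg _) h2)]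
    exact mul_le_one₀ h1 h2 (min_le_left _ _)
  have hlim : Tendsto (fun n => ∫ y, v n y * f y ∂μ) atTop (𝓝 (∫ y, K.indicator f y ∂μ)) := by
    refine tendsto_integral_of_dominated_convergence (fun y => |f y|)
      (fun n => (hvc n).aestronglyMeasurable.mul hf.1) hf.abs (fun n => ?_) ?_
    · refine Eventually.of_forall fun y => ?_
      rw [Real.norm_eq_abs, abs_mul]
      exact mul_le_of_le_one_left (abs_nonneg _) (hv1 n y)
    · filter_upwards [measure_eq_zero_iff_ae_notMem.1 measure_boundary] with y hy
      have hd : 0 < Metric.infDist y (V 0) := (hV.notMem_iff_infDist_pos hVne).1 hy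
      have t1 : Tendsto (fun n : ℕ => (thickenedIndicator (hpos n) K y : ℝ)) atTop
          (𝓝 (K.indicator (fun _ => (1 : ℝ)) y)) := by
        have := (tendsto_pi_nhds.1 (thickenedIndicator_tendsto_indicator_closure hpos
          tendsto_one_div_add_atTop_nhds_zero_nat K)) y
        rw [hK.closure_eq] at this
        have e : K.indicator (fun _ => (1 : ℝ)) y =
            NNReal.toReal (K.indicator (fun _ => (1 : NNReal)) y) := by
          by_cases hyK : y ∈ K
          · rw [Set.indicator_of_mem hyK, Set.indicator_of_mem hyK, NNReal.coe_one]
          · rw [Set.indicator_of_notMem hyK, Set.indicator_of_notMem hyK, NNReal.coe_zero]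
        rw [e]
        exact (NNReal.continuous_coe.tendsto _).comp this
      have t2 : Tendsto (fun n : ℕ => min 1 ((n : ℝ) * Metric.infDist y (V 0))) atTop (𝓝 1) := by
        refine tendsto_const_nhds.congr' ?_
        have := (tendsto_natCast_atTop_atTop (R := ℝ)).atTop_mul_const hd
        filter_upwards [this.eventually_ge_atTop 1] with n hn
        exact (min_eq_left hn).symm
      convert (t1.mul t2).mul_const (f y) using 2
      by_cases hyK : y ∈ K <;> simp [hyK]
  simp only [h _ (hvc _) (hv0 _)] at hlim
  exact tendsto_nhds_unique hlim tendsto_const_nhds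

/-! ### The Green's operator -/

/-- The Green's operator `f ↦ ∫ G(·, y) f(y) dμ(y)`. -/
def greenOp (f : SG → ℝ) (x : SG) : ℝ := ∫ y, green x y * f y ∂μ

theorem integrable_mul_of_continuous {f v : SG → ℝ} (hf : Integrable f μ) (hv : Continuous v) :
    Integrable (fun y => v y * f y) μ := by
  obtain ⟨B, hB⟩ := (isCompact_range hv.abs).bddAbove
  exact hf.bdd_mul hv.aestronglyMeasurable (Eventually.of_forall fun y => hB ⟨y, rfl⟩)

theorem integrable_green_mul {f : SG → ℝ} (hf : Integrable f μ) (x : SG) :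
    Integrable (fun y => green x y * f y) μ :=
  integrable_mul_of_continuous hf (continuous_green_right x)

theorem continuous_greenOp {f : SG → ℝ} (hf : Integrable f μ) : Continuous (greenOp f) := by
  obtain ⟨C, hC⟩ := exists_abs_green_le
  refine continuous_of_dominated (bound := fun y => C * |f y|)
    (fun x => (integrable_green_mul hf x).1) (fun x => ?_) (hf.abs.const_mul C) ?_
  · refine Eventually.of_forall fun y => ?_
    rw [Real.norm_eq_abs, abs_mul]
    exact mul_le_mul_of_nonneg_right (hC x y) (abs_nonneg _)
  · exact Eventually.of_forall fun y =>
      (continuous_green.comp (Continuous.prodMk_left y)).mul continuous_const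

theorem greenOp_of_mem_boundary (f : SG → ℝ) {z : SG} (hz : z ∈ V 0) : greenOp f z = 0 := by
  simp [greenOp, green_of_mem_boundary hz]

theorem graphEnergy_integral (n : ℕ) {K : SG → SG → ℝ} (hK : ∀ x, Integrable (K x) μ)
    (v : SG → ℝ) : graphEnergy n (fun x => ∫ y, K x y ∂μ) v =
      ∫ y, graphEnergy n (fun x => K x y) v ∂μ := by
  have hi : ∀ (a b : SG) (c : ℝ), Integrable (fun y => (K a y - K b y) * c) μ := fun a b c =>
    ((hK a).sub (hK b)).mul_const c
  simp only [graphEnergy]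
  rw [integral_const_mul, integral_finsetSum _ fun w _ => integrable_finsetSum _ fun i _ =>
    integrable_finsetSum _ fun j _ => hi _ _ _]
  congr 1
  refine Finset.sum_congr rfl fun w _ => ?_
  rw [integral_finsetSum _ fun i _ => integrable_finsetSum _ fun j _ => hi _ _ _]
  refine Finset.sum_congr rfl fun i _ => ?_
  rw [integral_finsetSum _ fun j _ => hi _ _ _]
  refine Finset.sum_congr rfl fun j _ => ?_
  rw [integral_mul_const, integral_sub (hK _) (hK _)]

theorem graphEnergy_greenOp (n : ℕ) {f : SG → ℝ} (hf : Integrable f μ) {v : SG → ℝ}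
    (hv : ∀ z ∈ V 0, v z = 0) :
    graphEnergy n (greenOp f) v = ∫ y, interp n v y * f y ∂μ := by
  unfold greenOp
  rw [graphEnergy_integral n (integrable_green_mul hf)]
  refine integral_congr_ae (Eventually.of_forall fun y => ?_)
  beta_reduce
  rw [graphEnergy_mul_left, ← graphEnergy_greenPartial n y hv]
  congr 1
  refine graphEnergy_congr (fun z hz => ?_) fun _ _ => rfl
  rw [green_comm, green_eq_greenPartial y hz]

theorem tendsto_graphEnergy_greenOp {f : SG → ℝ} (hf : Integrable f μ) {v : SG → ℝ}
    (hvc : Continuous v) (hv : ∀ z ∈ V 0, v z = 0) :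
    Tendsto (fun n => graphEnergy n (greenOp f) v) atTop (𝓝 (∫ y, v y * f y ∂μ)) := by
  simp only [graphEnergy_greenOp _ hf hv]
  obtain ⟨B, hB⟩ := (isCompact_range hvc.abs).bddAbove
  refine tendsto_integral_of_dominated_convergence (fun y => B * |f y|)
    (fun n => (integrable_mul_of_continuous hf (continuous_interp n v)).1) (hf.abs.const_mul B)
    (fun n => ?_) ?_
  · refine Eventually.of_forall fun y => ?_
    rw [Real.norm_eq_abs, abs_mul]
    exact mul_le_mul_of_nonneg_right (abs_interp_le (fun x => hB ⟨x, rfl⟩) n y) (abs_nonneg _)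
  · exact Eventually.of_forall fun y => (tendsto_interp hvc y).mul_const (f y)

theorem greenOp_mem_domE {f : SG → ℝ} (hf : Integrable f μ) : greenOp f ∈ domE :=
  ⟨continuous_greenOp hf, (tendsto_graphEnergy_greenOp hf (continuous_greenOp hf)
    fun _ hz => greenOp_of_mem_boundary f hz).bddAbove_range⟩

/-! ### The Laplacian -/

theorem isLaplacian_greenOp (f : Lp ℝ 2 μ) : IsLaplacian (greenOp f) (-f) := by
  have hf := integrable_of_Lp f
  refine ⟨greenOp_mem_domE hf, fun v hv => ?_⟩
  rw [energy, (tendsto_graphEnergy_greenOp hf hv.1.1 hv.2).limUnder_eq, ← integral_neg]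
  refine integral_congr_ae ?_
  filter_upwards [Lp.coeFn_neg f] with y hy
  rw [hy, Pi.neg_apply]
  ring

/-- The Dirichlet problem has at most one solution. Only piecewise harmonic test functions are
needed, for which the energy is the energy on a graph. -/
theorem eq_of_isLaplacian {u v : SG → ℝ} {f : Lp ℝ 2 μ} (hu : IsLaplacian u f)
    (hv : IsLaplacian v f) (hu0 : ∀ z ∈ V 0, u z = 0) (hv0 : ∀ z ∈ V 0, v z = 0) : u = v := by
  have h := eq_zero_of_graphEnergy_eq_zero (u := fun x => u x - v x) (hu.1.1.sub hv.1.1)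
    (fun z hz => by simp [hu0 z hz, hv0 z hz]) fun m => ?_
  · funext x
    exact sub_eq_zero.1 (congrFun h x)
  have hw := interp_harmonic m fun x => u x - v x
  have hw0 : interp m (fun x => u x - v x) ∈ domE₀ := ⟨hw.mem_domE, fun z hz => by
    rw [interp_apply _ (monotone_V m.zero_le hz), hu0 z hz, hv0 z hz, sub_zero]⟩
  have e := (hu.2 _ hw0).trans (hv.2 _ hw0).symm
  rw [energy_of_harmonic hw, energy_of_harmonic hw, ← sub_eq_zero, ← graphEnergy_sub_left] at e
  rw [← e]
  exact graphEnergy_congr (fun _ _ => rfl) fun z hz => (interp_apply (fun x => u x - v x) hz).symm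

theorem eq_greenOp_of_isLaplacian {u : SG → ℝ} {f : Lp ℝ 2 μ} (hu : IsLaplacian u f)
    (hu0 : ∀ z ∈ V 0, u z = 0) : u = greenOp ↑(-f) := by
  refine eq_of_isLaplacian hu ?_ hu0 fun z hz => greenOp_of_mem_boundary _ hz
  simpa using isLaplacian_greenOp (-f)

theorem greenOp_injective {f g : Lp ℝ 2 μ} (h : greenOp f = greenOp g) : f = g := by
  have hf := integrable_of_Lp f
  have hg := integrable_of_Lp g
  have h0 : (fun y => f y - g y) =ᵐ[μ] 0 := by
    refine ae_eq_zero_of_integral_continuous (hf.sub hg) fun v hvc hv => ?_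
    have tf := tendsto_graphEnergy_greenOp hf hvc hv
    rw [h] at tf
    have e := tendsto_nhds_unique tf (tendsto_graphEnergy_greenOp hg hvc hv)
    simp only [mul_sub]
    rw [integral_sub (integrable_mul_of_continuous hf hvc) (integrable_mul_of_continuous hg hvc),
      e, sub_self]
  refine Lp.ext ?_
  filter_upwards [h0] with y hy
  exact sub_eq_zero.1 hy

theorem laplacian_greenOp (f : Lp ℝ 2 μ) : laplacian (greenOp f) = -f := by
  have hex : ∃ g, IsLaplacian (greenOp f) g := ⟨_, isLaplacian_greenOp f⟩
  have hl : IsLaplacian (greenOp f) (laplacian (greenOp f)) := by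
    rw [laplacian, dif_pos hex]
    exact hex.choose_spec
  rw [eq_comm, neg_eq_iff_eq_neg]
  exact greenOp_injective (eq_greenOp_of_isLaplacian hl fun z hz => greenOp_of_mem_boundary _ hz)

theorem T_greenOp (f : Lp ℝ 2 μ) : T (greenOp f) = ∫ y, f y ^ 2 ∂μ := by
  rw [T, laplacian_greenOp]
  refine integral_congr_ae ?_
  filter_upwards [Lp.coeFn_neg f] with y hy
  rw [hy, Pi.neg_apply, neg_sq]

/-! ### The Gram matrix and the minimization problem -/

theorem memLp_green (x : SG) : MemLp (green x) 2 μ := by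
  obtain ⟨C, hC⟩ := exists_abs_green_le
  exact MemLp.of_bound (continuous_green_right x).aestronglyMeasurable C
    (Eventually.of_forall fun y => hC x y)

/-- The element `∑ i, c i * G(x i, ·)` of `L²`. -/
def greenComb {n : ℕ} (x : Fin n → SG) (c : Fin n → ℝ) : Lp ℝ 2 μ :=
  (memLp_finsetSum Finset.univ fun i _ => (memLp_green (x i)).const_mul (c i)).toLp
    fun y => ∑ i, c i * green (x i) y

theorem coeFn_greenComb {n : ℕ} (x : Fin n → SG) (c : Fin n → ℝ) :
    greenComb x c =ᵐ[μ] fun y => ∑ i, c i * green (x i) y :=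
  MemLp.coeFn_toLp _

theorem integral_greenComb_mul {n : ℕ} (x : Fin n → SG) (c : Fin n → ℝ) {f : SG → ℝ}
    (hf : Integrable f μ) :
    ∫ y, greenComb x c y * f y ∂μ = ∑ i, c i * greenOp f (x i) := by
  have e : (fun y => greenComb x c y * f y) =ᵐ[μ]
      fun y => ∑ i, c i * (green (x i) y * f y) := by
    filter_upwards [coeFn_greenComb x c] with y hy
    simp only [hy, Finset.sum_mul, mul_assoc]
  rw [integral_congr_ae e, integral_finsetSum _ fun i _ =>
    (integrable_green_mul hf (x i)).const_mul (c i)]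
  simp only [integral_const_mul, greenOp]

theorem greenOp_greenComb {n : ℕ} (x : Fin n → SG) (c : Fin n → ℝ) (p : SG) :
    greenOp (greenComb x c) p = ∑ i, c i * greenIter p (x i) := by
  have hi : ∀ z, Integrable (green z) μ := fun z => (memLp_green z).integrable one_le_two
  have h := integral_greenComb_mul x c (hi p)
  rw [greenOp]
  simp only [mul_comm (green p _)]
  rw [h]
  refine Finset.sum_congr rfl fun i _ => ?_
  simp only [greenOp, greenIter, mul_comm]

/-- Green's functions with poles at distinct interior points are linearly independent: a linear
relation between them annihilates, by the reproducing property, all interpolations of functions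
that vanish on the boundary, and one of these separates a pole from the others. -/
theorem eq_zero_of_sum_green_eq_zero {n : ℕ} {x : Fin n → SG} (hx : Function.Injective x)
    (hV : ∀ i, x i ∉ V 0) {c : Fin n → ℝ} (h : ∀ y, ∑ i, c i * green (x i) y = 0) : c = 0 := by
  classical
  have hinterp : ∀ m, ∀ v : SG → ℝ, (∀ z ∈ V 0, v z = 0) → ∑ i, c i * interp m v (x i) = 0 := by
    intro m v hv
    have e : graphEnergy m (fun y => ∑ i, c i * greenPartial m (x i) y) v = 0 := by
      rw [graphEnergy_congr (u' := fun _ => 0) (v' := v) (fun z hz => ?_) fun _ _ => rfl]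
      · simp [graphEnergy]
      · rw [← h z]
        exact Finset.sum_congr rfl fun i _ => by rw [green_eq_greenPartial _ hz]
    have lin : ∀ s : Finset (Fin n),
        graphEnergy m (fun y => ∑ i ∈ s, c i * greenPartial m (x i) y) v =
          ∑ i ∈ s, c i * graphEnergy m (greenPartial m (x i)) v := by
      intro s
      induction s using Finset.induction_on with
      | empty => simp [graphEnergy]
      | insert a s ha ih =>
        simp only [Finset.sum_insert ha]
        rw [graphEnergy_add_left, ih]
        congr 1
        simp only [mul_comm (c a)]
        exact graphEnergy_mul_left _ _ _ _
    rw [← e, lin]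
    exact Finset.sum_congr rfl fun i _ => by rw [graphEnergy_greenPartial m _ hv]
  funext i
  let D : ℕ → ℝ := fun m => (1 / 2 : ℝ) ^ m * Metric.diam (Set.univ : Set SG)
  have hsmall : ∀ z, z ≠ x i → ∀ᶠ m in atTop, 2 * D m < dist z (x i) := fun z hz => by
    have := tendsto_cellSize.const_mul 2
    rw [mul_zero] at this
    exact this.eventually (gt_mem_nhds (dist_pos.2 hz))
  have hD : ∀ m, 0 ≤ D m := fun m => mul_nonneg (by positivity) Metric.diam_nonneg
  have h1 : ∀ᶠ m in atTop, ∀ z ∈ V 0, 2 * D m < dist z (x i) :=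
    (Filter.eventually_all_finite (finite_V 0)).2 fun z hz => hsmall z fun e => hV i (e ▸ hz)
  have h2 : ∀ᶠ m in atTop, ∀ j, j ≠ i → 2 * D m < dist (x j) (x i) :=
    eventually_all.2 fun j => by
      by_cases hj : j = i
      · exact Eventually.of_forall fun m hne => absurd hj hne
      · exact (hsmall _ (hx.ne hj)).mono fun m hm _ => hm
  obtain ⟨m, hm1, hm2⟩ := (h1.and h2).exists
  let v : SG → ℝ := fun z => if dist z (x i) ≤ D m then 1 else 0
  have hv0 : ∀ z ∈ V 0, v z = 0 := fun z hz =>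
    if_neg (not_le.2 (by linarith [hm1 z hz, hD m]))
  have hvi : interp m v (x i) = 1 := by
    have := interp_mem_Icc (m := m) (v := v) (x := x i) (a := 1) (b := 1) fun z hz => by
      simp [v, show dist z (x i) ≤ D m from hz]
    simpa using this
  have hvj : ∀ j, j ≠ i → interp m v (x j) = 0 := fun j hj => by
    have := interp_mem_Icc (m := m) (v := v) (x := x j) (a := 0) (b := 0) fun z hz => by
      have hn : ¬ dist z (x i) ≤ D m := fun hz' => by
        have t := dist_triangle_left (x j) (x i) z
        have : dist z (x j) ≤ D m := hz
        linarith [hm2 j hj]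
      simp [v, if_neg hn]
    simpa using this
  have hs := hinterp m v hv0
  rw [Finset.sum_eq_single i (fun j _ hj => by rw [hvj j hj, mul_zero]) (by simp), hvi,
    mul_one] at hs
  exact hs

theorem isUnit_gram {n : ℕ} {x : Fin n → SG} (hx : Function.Injective x)
    (hV : ∀ i, x i ∉ V 0) : IsUnit (Matrix.of fun i j => greenIter (x i) (x j)) := by
  rw [← Matrix.mulVec_injective_iff_isUnit]
  refine (injective_iff_map_eq_zero
    (Matrix.of fun i j => greenIter (x i) (x j)).mulVecLin).2 fun c hc => ?_
  have hc' : ∀ j, greenOp (greenComb x c) (x j) = 0 := fun j => by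
    rw [greenOp_greenComb]
    refine Eq.trans ?_ (congrFun hc j)
    simp [Matrix.mulVec, dotProduct, mul_comm]
  -- The quadratic form of the matrix is the square of the norm of `greenComb x c`.
  have hsq : ∫ y, greenComb x c y ^ 2 ∂μ = 0 := by
    simp only [pow_two]
    rw [integral_greenComb_mul x c (integrable_of_Lp _)]
    simp [hc']
  have hae : (fun y => ∑ i, c i * green (x i) y) =ᵐ[μ] 0 := by
    have h0 := (integral_eq_zero_iff_of_nonneg (fun y => sq_nonneg _)
      (Lp.memLp (greenComb x c)).integrable_sq).1 hsq
    filter_upwards [h0, coeFn_greenComb x c] with y hy hy'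
    rw [← hy']
    exact pow_eq_zero_iff two_ne_zero |>.1 hy
  have hcont : Continuous fun y => ∑ i, c i * green (x i) y :=
    continuous_finsetSum _ fun i _ => continuous_const.mul (continuous_green_right (x i))
  exact eq_zero_of_sum_green_eq_zero hx hV
    (congrFun ((hcont.ae_eq_iff_eq μ continuous_const).1 hae))

/-- The Pythagorean theorem in `L²`: every competitor has a Laplacian that differs from that of
`greenOp (greenComb x c)` by an element orthogonal to all `green (x i)`. -/
theorem T_lt_of_mem_admissible {n : ℕ} {x : Fin n → SG} {a c : Fin n → ℝ}
    (hc : ∀ j, greenOp (greenComb x c) (x j) = a j) {v : SG → ℝ} (hv : v ∈ admissible x a)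
    (hne : v ≠ greenOp (greenComb x c)) : T (greenOp (greenComb x c)) < T v := by
  obtain ⟨⟨g, hg⟩, hv0, hva⟩ := hv
  obtain ⟨f, rfl⟩ : ∃ f : Lp ℝ 2 μ, v = greenOp f := ⟨-g, eq_greenOp_of_isLaplacian hg hv0⟩
  set k := greenComb x c with hk
  rw [T_greenOp, T_greenOp]
  have hk2 := (Lp.memLp k).integrable_sq
  have hd2 : Integrable (fun y => (f y - k y) ^ 2) μ :=
    ((Lp.memLp f).sub (Lp.memLp k)).integrable_sq
  have hfi := integrable_of_Lp f
  have hki := integrable_of_Lp k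
  have hkf : Integrable (fun y => k y * f y) μ := (Lp.memLp k).integrable_mul (Lp.memLp f)
  have hkk : Integrable (fun y => k y * k y) μ := (Lp.memLp k).integrable_mul (Lp.memLp k)
  have horth : ∫ y, k y * f y ∂μ = ∫ y, k y * k y ∂μ := by
    rw [hk, integral_greenComb_mul x c hfi, integral_greenComb_mul x c hki]
    simp only [hva, hc]
  have hpos : 0 < ∫ y, (f y - k y) ^ 2 ∂μ := by
    refine lt_of_le_of_ne (integral_nonneg fun y => sq_nonneg _) fun h0 => hne ?_
    have h1 := (integral_eq_zero_iff_of_nonneg (fun y => sq_nonneg _) hd2).1 h0.symm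
    have h2 : f = k := Lp.ext <| by
      filter_upwards [h1] with y hy
      exact sub_eq_zero.1 (pow_eq_zero_iff two_ne_zero |>.1 hy)
    rw [h2]
  have hexp : ∫ y, f y ^ 2 ∂μ = ∫ y, (f y - k y) ^ 2 ∂μ +
      2 * (∫ y, k y * f y ∂μ - ∫ y, k y * k y ∂μ) + ∫ y, k y ^ 2 ∂μ := by
    have hd : Integrable (fun y => 2 * (k y * f y - k y * k y)) μ := (hkf.sub hkk).const_mul 2
    have hs : Integrable (fun y => (f y - k y) ^ 2 + 2 * (k y * f y - k y * k y)) μ := hd2.add hd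
    rw [← integral_sub hkf hkk, ← integral_const_mul, ← integral_add hd2 hd, ← integral_add hs hk2]
    refine integral_congr_ae (Eventually.of_forall fun y => ?_)
    ring
  rw [horth, sub_self, mul_zero, add_zero] at hexp
  linarith

end Gasket

end

theorem mainTheorem12 (n : ℕ) (x : Fin n → Gasket.SG) (hx : Function.Injective x)
    (hV : ∀ i, x i ∉ Gasket.V 0) :
    IsUnit (Matrix.of fun i j => Gasket.greenIter (x i) (x j)) ∧
    ∀ a : Fin n → ℝ,
      (∃! c : Fin n → ℝ, ∀ j, ∑ i, c i * Gasket.greenIter (x j) (x i) = a j) ∧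
      ∀ c : Fin n → ℝ, (∀ j, ∑ i, c i * Gasket.greenIter (x j) (x i) = a j) →
        (fun p => ∑ i, c i * Gasket.greenIter p (x i)) ∈ Gasket.admissible x a ∧
        ∀ v ∈ Gasket.admissible x a, v ≠ (fun p => ∑ i, c i * Gasket.greenIter p (x i)) →
          Gasket.T (fun p => ∑ i, c i * Gasket.greenIter p (x i)) < Gasket.T v := by
  have hu : ∀ c : Fin n → ℝ, (fun p => ∑ i, c i * Gasket.greenIter p (x i)) =
      Gasket.greenOp (Gasket.greenComb x c) := fun c =>
    funext fun p => (Gasket.greenOp_greenComb x c p).symm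
  have hM := Gasket.isUnit_gram hx hV
  refine ⟨hM, fun a => ⟨?_, fun c hc => ?_⟩⟩
  · have hiff : ∀ c : Fin n → ℝ, (∀ j, ∑ i, c i * Gasket.greenIter (x j) (x i) = a j) ↔
        (Matrix.of fun i j => Gasket.greenIter (x i) (x j)).mulVec c = a := fun c => by
      rw [funext_iff]
      simp [Matrix.mulVec, dotProduct, mul_comm]
    simp only [hiff]
    have hinj := Matrix.mulVec_injective_iff_isUnit.2 hM
    obtain ⟨c, hc⟩ := Matrix.mulVec_surjective_iff_isUnit.2 hM a
    exact ⟨c, hc, fun c' hc' => hinj (hc'.trans hc.symm)⟩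
  · have hc' : ∀ j, Gasket.greenOp (Gasket.greenComb x c) (x j) = a j := fun j => by
      rw [Gasket.greenOp_greenComb, hc]
    rw [hu]
    exact ⟨⟨⟨_, Gasket.isLaplacian_greenOp _⟩,
      fun p hp => Gasket.greenOp_of_mem_boundary _ hp, hc'⟩,
      fun v hv hne => Gasket.T_lt_of_mem_admissible hc' hv hne⟩
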